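/- Let $G=\mathbb{Z}^2\rtimes \mathrm{SL}(2,\mathbb{Z})$, acting on $\mathbb{Z}^2$ by $(k,\gamma)\cdot m=k+\gamma m$. For an abelian group $H$ let $\Lambda(H)$ be the group of finitely supported functions $\lambda:\mathbb{Z}^2\to H$ with $\sum_{m}\lambda(m)=0$, on which $G$ acts by $(g\cdot\lambda)(m)=\lambda(g^{-1}\cdot m)$. Let $N(H,1)=L(\Lambda(H))$ be the group von Neumann algebra, that is, the double commutant of the left regular representation $u$ of $\Lambda(H)$ on $\ell^2(\Lambda(H))$, with trace $\tau(x)=\langle x\delta_0,\delta_0\rangle$, and let $\beta(H,1,1)$ be the action of $G$ on $N(H,1)$ by $*$-automorphisms determined by $u(\lambda)\mapsto u(g\cdot\lambda)$, implemented by the unitaries $\delta_\lambda\mapsto\delta_{g\cdot\lambda}$. **Corollary 5.2.** Let $H\neq\{0\}$ be a countable discrete abelian group and let $(X,\mu)$ be a non-atomic standard probability space. Then there is an action $\beta$ of $G$ on $L^\infty(X,\mu)$ by $*$-automorphisms such that 1. $\beta$ is trace preserving: $\int\beta_g(f)\,d\mu=\int f\,d\mu$ for all $g\in G$, $f\in L^\infty(X,\mu)$;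 2. $\beta$ is essentially free: for every $g\ne 1$ there is a measure preserving transformation $T$ of $(X,\mu)$ with $\beta_g(f)=f\circ T$ almost everywhere for all $f\in L^\infty(X,\mu)$, and $T x\neq x$ for almost every $x$; 3. $\beta$ is ergodic: every $f\in L^\infty(X,\mu)$ with $\beta_g(f)=f$ for all $g\in G$ is almost everywhere constant; 4. $\beta$ is conjugate to $\beta(H,1,1)$: there is a $*$-isomorphism $\Theta:N(H,1)\to L^\infty(X,\mu)$ with $\int\Theta(x)\,d\mu=\tau(x)$ and $\Theta(\beta(H,1,1)_g(x))=\beta_g(\Theta(x))$ for all $x\in N(H,1)$, $g\in G$; 5. $\mathrm{Aut}(L^\infty(X,\mu),\beta)\cong\mathrm{Aut}(H)$ as topological groups, where $\mathrm{Aut}(L^\infty(X,\mu),\beta)$ is the group of all $*$-automorphisms of $L^\infty(X,\mu)$ that commute with every $\beta_g$, with the topology of pointwise convergence in the $2$-norm $\|f\|_2=(\int|f|^2d\mu)^{1/2}$, and $\mathrm{Aut}(H)$ is the group of automorphisms of $H$, with the topology of pointwise convergence. -/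

import Mathlib

open MeasureTheory
open scoped ENNReal

noncomputable section

namespace BernoulliShift

/-! ### The group `ℤ² ⋊ SL(2, ℤ)` and its affine action on `ℤ²` -/

/-- The action of `SL(2, ℤ)` on `ℤ²` by matrix multiplication, as automorphisms of the group `ℤ²`
(written multiplicatively). -/
def slAut : Matrix.SpecialLinearGroup (Fin 2) ℤ →* MulAut (Multiplicative (Fin 2 → ℤ)) where
  toFun A := AddEquiv.toMultiplicative (Matrix.SpecialLinearGroup.toLin' A).toAddEquiv
  map_one' := by ext x; simp
  map_mul' A B := by ext x; simp

/-- The group `ℤ² ⋊ SL(2, ℤ)`. -/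
abbrev AffineSL : Type :=
  Multiplicative (Fin 2 → ℤ) ⋊[slAut] Matrix.SpecialLinearGroup (Fin 2) ℤ

/-- The action `(k, A) • m = k + A m` of `ℤ² ⋊ SL(2, ℤ)` on `ℤ²`. -/
instance : MulAction AffineSL (Fin 2 → ℤ) where
  smul g m := g.left.toAdd + g.right.1.mulVec m
  one_smul m := by
    change (1 : AffineSL).left.toAdd + (1 : AffineSL).right.1.mulVec m = m
    simp
  mul_smul g h m := by
    change (g * h).left.toAdd + (g * h).right.1.mulVec m =
      g.left.toAdd + g.right.1.mulVec (h.left.toAdd + h.right.1.mulVec m)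
    rw [SemidirectProduct.mul_left, SemidirectProduct.mul_right,
      Matrix.SpecialLinearGroup.coe_mul, Matrix.mulVec_add, Matrix.mulVec_mulVec, ← add_assoc]
    rfl

/-! ### The group `Λ(H)` -/

section Lambda

variable (H : Type*) [AddCommGroup H]

/-- `Λ(H)`: the finitely supported functions `ℤ² → H` whose values sum to `0`. -/
def Lam : AddSubgroup ((Fin 2 → ℤ) →₀ H) :=
  (Finsupp.liftAddHom fun _ : Fin 2 → ℤ => AddMonoidHom.id H).ker

variable {H} in
theorem mem_lam {l : (Fin 2 → ℤ) →₀ H} : l ∈ Lam H ↔ l.sum (fun _ h => h) = 0 := Iff.rfl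

variable {H} in
theorem equivMapDomain_mem_lam (e : Equiv.Perm (Fin 2 → ℤ)) {l : (Fin 2 → ℤ) →₀ H}
    (hl : l ∈ Lam H) : Finsupp.equivMapDomain e l ∈ Lam H := by
  rw [mem_lam] at hl ⊢
  rw [Finsupp.sum_equivMapDomain]
  exact hl

/-- The action `(g · l)(m) = l (g⁻¹ • m)` of `ℤ² ⋊ SL(2, ℤ)` on `Λ(H)`. -/
def lamAct : AffineSL →* Equiv.Perm (Lam H) where
  toFun g :=
    { toFun := fun l => ⟨Finsupp.equivMapDomain (MulAction.toPerm g) l.1,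
        equivMapDomain_mem_lam _ l.2⟩
      invFun := fun l => ⟨Finsupp.equivMapDomain (MulAction.toPerm g⁻¹) l.1,
        equivMapDomain_mem_lam _ l.2⟩
      left_inv := fun l => by
        ext m
        simp
      right_inv := fun l => by
        ext m
        simp }
  map_one' := by
    ext l m
    simp
  map_mul' g h := by
    ext l m
    simp [mul_smul]

variable {H}

theorem lamAct_apply (g : AffineSL) (l : Lam H) (m : Fin 2 → ℤ) :
    (lamAct H g l).1 m = l.1 (g⁻¹ • m) := rfl

theorem lamAct_add (g : AffineSL) (l l' : Lam H) :
    lamAct H g (l + l') = lamAct H g l + lamAct H g l' := by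
  ext m
  rfl

end Lambda

/-! ### The group von Neumann algebra `N(H) = L(Λ(H))` and the Bernoulli shift action -/

/-- The Hilbert space `ℓ²(ι)`. -/
abbrev ell2 (ι : Type*) : Type _ := lp (fun _ : ι => ℂ) 2

theorem memlp_comp {ι : Type*} (e : Equiv.Perm ι) (f : ell2 ι) :
    Memℓp (fun i => f (e i)) 2 := by
  have h := lp.memℓp f
  rw [memℓp_gen_iff (by norm_num)] at h ⊢
  exact (e.summable_iff (f := fun i => ‖f i‖ ^ (2 : ℝ≥0∞).toReal)).2 h

/-- The unitary operator on `ℓ²(ι)` that permutes coordinates: `(e f)(i) = f (e⁻¹ i)`, so that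
the basis vector `δ_i` goes to `δ_{e i}`. -/
def permIsometry {ι : Type*} : Equiv.Perm ι →* (ell2 ι ≃ₗᵢ[ℂ] ell2 ι) where
  toFun e :=
    { toFun := fun f => ⟨fun i => f (e.symm i), memlp_comp e.symm f⟩
      invFun := fun f => ⟨fun i => f (e i), memlp_comp e f⟩
      map_add' := fun f g => rfl
      map_smul' := fun c f => rfl
      left_inv := fun f => lp.ext (funext fun i => congrArg f (e.symm_apply_apply i))
      right_inv := fun f => lp.ext (funext fun i => congrArg f (e.apply_symm_apply i))
      norm_map' := fun f => by
        rw [lp.norm_eq_tsum_rpow (by norm_num), lp.norm_eq_tsum_rpow (by norm_num)]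
        congr 1
        exact e.symm.tsum_eq (fun i => ‖f i‖ ^ (2 : ℝ≥0∞).toReal) }
  map_one' := rfl
  map_mul' e e' := rfl

/-- The permutation operator of `permIsometry` as a unitary element of `B(ℓ²(ι))`. -/
def permUnitary {ι : Type*} : Equiv.Perm ι →* unitary (ell2 ι →L[ℂ] ell2 ι) :=
  (Unitary.linearIsometryEquiv (𝕜 := ℂ) (H := ell2 ι)).symm.toMonoidHom.comp permIsometry

/-- The restriction of an action by *-automorphisms to an invariant *-subalgebra. -/
def restrictAction {G A : Type*} [Group G] [Ring A] [StarRing A] [Algebra ℂ A] [StarModule ℂ A]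
    (S : StarSubalgebra ℂ A) (ρ : G →* (A ≃⋆ₐ[ℂ] A)) (hρ : ∀ g, ∀ x ∈ S, ρ g x ∈ S) :
    G →* (S ≃⋆ₐ[ℂ] S) where
  toFun g :=
    { toFun := fun x => ⟨ρ g x.1, hρ g x.1 x.2⟩
      invFun := fun x => ⟨ρ g⁻¹ x.1, hρ g⁻¹ x.1 x.2⟩
      left_inv := fun x => Subtype.ext (by simp [← StarAlgEquiv.mul_apply])
      right_inv := fun x => Subtype.ext (by simp [← StarAlgEquiv.mul_apply])
      map_mul' := fun x y => Subtype.ext (map_mul (ρ g) x.1 y.1)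
      map_add' := fun x y => Subtype.ext (map_add (ρ g) x.1 y.1)
      map_star' := fun x => Subtype.ext (map_star (ρ g) x.1)
      map_smul' := fun c x => Subtype.ext (map_smul (ρ g) c x.1) }
  map_one' := by
    ext1 x
    apply Subtype.ext
    change ρ 1 x.1 = x.1
    rw [map_one]
    rfl
  map_mul' g h := by
    ext1 x
    apply Subtype.ext
    change ρ (g * h) x.1 = ρ g (ρ h x.1)
    rw [map_mul]
    rfl

/-- Automorphisms that preserve a set preserve its commutant. -/
theorem centralizer_invariant {G A : Type*} [Group G] [Ring A] [StarRing A] [Algebra ℂ A]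
    [StarModule ℂ A] (ρ : G →* (A ≃⋆ₐ[ℂ] A)) (s : Set A) (hs : ∀ g, ∀ a ∈ s, ρ g a ∈ s)
    (g : G) (x : A) (hx : x ∈ StarSubalgebra.centralizer ℂ s) :
    ρ g x ∈ StarSubalgebra.centralizer ℂ s := by
  rw [StarSubalgebra.mem_centralizer_iff] at hx ⊢
  intro a ha
  have ea : a = ρ g (ρ g⁻¹ a) := by
    rw [← StarAlgEquiv.mul_apply, ← map_mul, mul_inv_cancel, map_one, StarAlgEquiv.one_apply]
  obtain ⟨h1, h2⟩ := hx _ (hs g⁻¹ a ha)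
  rw [ea, ← map_star, ← map_mul, ← map_mul, ← map_mul, ← map_mul, h1, h2]
  exact ⟨rfl, rfl⟩

section GroupAlgebra

/-- The left regular representation `u(l) δ_{l'} = δ_{l + l'}` of an abelian group. -/
def leftReg {L : Type*} [AddCommGroup L] (l : L) : ell2 L →L[ℂ] ell2 L :=
  (permUnitary (Equiv.addLeft l) : ell2 L →L[ℂ] ell2 L)

/-- The group von Neumann algebra `L(L) = {u(l)}''`, the double commutant of the left regular
representation. -/
def groupVN (L : Type*) [AddCommGroup L] : VonNeumannAlgebra (ell2 L) where
  toStarSubalgebra := StarSubalgebra.centralizer ℂ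
    (StarSubalgebra.centralizer ℂ (Set.range (leftReg (L := L))) : Set (ell2 L →L[ℂ] ell2 L))
  centralizer_centralizer' := by simp

theorem leftReg_mem {L : Type*} [AddCommGroup L] (l : L) :
    leftReg l ∈ (groupVN L).toStarSubalgebra := by
  refine (StarSubalgebra.mem_centralizer_iff ℂ).2 fun y hy => ?_
  have hy' := (StarSubalgebra.mem_centralizer_iff ℂ).1 hy (leftReg l) ⟨l, rfl⟩
  refine ⟨hy'.1.symm, ?_⟩
  have h := congrArg star hy'.2
  simpa using h

open Classical in
/-- The basis vector `δ_0` of `ℓ²(L)`. -/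
def delta0 (L : Type*) [AddCommGroup L] : ell2 L := lp.single 2 0 1

/-- The canonical trace `τ(x) = ⟨x δ_0, δ_0⟩` (Mathlib's inner product is conjugate linear in its
first argument). -/
def canonicalTrace {L : Type*} [AddCommGroup L] (x : (groupVN L).toStarSubalgebra) : ℂ :=
  inner ℂ (delta0 L) (x.1 (delta0 L))

end GroupAlgebra

section Action

variable (H : Type*) [AddCommGroup H]

/-- `N(H) = L(Λ(H))`. -/
abbrev shiftVN : StarSubalgebra ℂ (ell2 (Lam H) →L[ℂ] ell2 (Lam H)) :=
  (groupVN (Lam H)).toStarSubalgebra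

/-- The unitary representation of `ℤ² ⋊ SL(2, ℤ)` on `ℓ²(Λ(H))`, `δ_l ↦ δ_{g · l}`. -/
def koopman : AffineSL →* unitary (ell2 (Lam H) →L[ℂ] ell2 (Lam H)) :=
  permUnitary.comp (lamAct H)

variable {H} in
/-- Conjugation by the representation carries `u(l)` to `u(g · l)`. -/
theorem koopman_conj_u (g : AffineSL) (l : Lam H) :
    Unitary.conjStarAlgAut ℂ _ (koopman H g) (leftReg l) = leftReg (lamAct H g l) := by
  have key : lamAct H g * Equiv.addLeft l = Equiv.addLeft (lamAct H g l) * lamAct H g := by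
    ext1 l'
    exact lamAct_add g l l'
  have h := congrArg Subtype.val (congrArg (permUnitary (ι := Lam H)) key)
  rw [map_mul, map_mul] at h
  change (koopman H g).1 * leftReg l = leftReg (lamAct H g l) * (koopman H g).1 at h
  rw [Unitary.conjStarAlgAut_apply, h, mul_assoc,
    Unitary.mul_star_self_of_mem (koopman H g).2, mul_one]

variable {H} in
theorem koopman_conj_mem (g : AffineSL) (x : ell2 (Lam H) →L[ℂ] ell2 (Lam H)) (hx : x ∈ shiftVN H) :
    Unitary.conjStarAlgAut ℂ _ (koopman H g) x ∈ shiftVN H := by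
  refine centralizer_invariant ((Unitary.conjStarAlgAut ℂ _).comp (koopman H)) _ ?_ g x hx
  refine centralizer_invariant ((Unitary.conjStarAlgAut ℂ _).comp (koopman H)) _ ?_
  rintro g _ ⟨l, rfl⟩
  exact ⟨lamAct H g l, (koopman_conj_u g l).symm⟩

/-- The action `β(H, 1, 1)` of `ℤ² ⋊ SL(2, ℤ)` on `N(H)`: conjugation by the unitary
representation above, so that `β(g)(u(l)) = u(g · l)`. -/
def shiftAction : AffineSL →* (shiftVN H ≃⋆ₐ[ℂ] shiftVN H) :=
  restrictAction (shiftVN H) ((Unitary.conjStarAlgAut ℂ _).comp (koopman H)) koopman_conj_mem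

theorem shiftAction_leftReg (g : AffineSL) (l : Lam H) :
    (shiftAction H g ⟨leftReg l, leftReg_mem l⟩ : ell2 (Lam H) →L[ℂ] ell2 (Lam H)) = leftReg (lamAct H g l) :=
  koopman_conj_u g l

theorem shiftAction_apply (g : AffineSL) (x : shiftVN H) :
    (shiftAction H g x : ell2 (Lam H) →L[ℂ] ell2 (Lam H)) =
      (koopman H g).1 * x.1 * star (koopman H g).1 := rfl

end Action

/-! ### The *-algebra `L^∞(X)` and group actions on it -/

section LInfty

variable {X : Type*} [MeasurableSpace X]

/-- The space `L^∞(X, μ)` of complex functions. -/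
abbrev LInfty (μ : Measure X) : Type _ := Lp ℂ ∞ μ

/-- The (almost everywhere) pointwise product on `L^∞(X, μ)`. -/
instance (μ : Measure X) : Mul (LInfty μ) where
  mul f g := (f • g : Lp ℂ ∞ μ)

variable {μ : Measure X} {G : Type*} [Group G]

/-- The action preserves the trace `f ↦ ∫ f dμ`. -/
def TracePreserving (β : G →* (LInfty μ ≃⋆ₐ[ℂ] LInfty μ)) : Prop :=
  ∀ (g : G) (f : LInfty μ), ∫ x, (β g f : LInfty μ) x ∂μ = ∫ x, f x ∂μ

/-- The only fixed elements are the scalars. -/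
def IsErgodic (β : G →* (LInfty μ ≃⋆ₐ[ℂ] LInfty μ)) : Prop :=
  ∀ f : LInfty μ, (∀ g, β g f = f) → ∃ c : ℂ, f =ᵐ[μ] fun _ => c

/-- Essential freeness of a trace preserving action: every `g ≠ 1` acts by a measure preserving
point transformation `T` of `X` (which is unique up to null sets when `X` is a standard Borel
space), and almost no point is fixed by `T`. -/
def IsEssentiallyFree (β : G →* (LInfty μ ≃⋆ₐ[ℂ] LInfty μ)) : Prop :=
  ∀ g : G, g ≠ 1 → ∃ T : X → X, MeasurePreserving T μ μ ∧
    (∀ f : LInfty μ, β g f =ᵐ[μ] f ∘ T) ∧ ∀ᵐ x ∂μ, T x ≠ x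

/-- The inclusion `L^∞ ⊆ L²` of a finite measure space. -/
def toL2 [IsFiniteMeasure μ] (f : LInfty μ) : Lp ℂ 2 μ :=
  MemLp.toLp f ((Lp.memLp f).mono_exponent le_top)

/-- The topology of pointwise convergence in the `2`-norm on `Aut(L^∞(X, μ))`. -/
instance [IsFiniteMeasure μ] : TopologicalSpace (LInfty μ ≃⋆ₐ[ℂ] LInfty μ) :=
  TopologicalSpace.induced (fun α (f : LInfty μ) => toL2 (α f)) Pi.topologicalSpace

/-- `Aut(L^∞(X, μ), β)`: the automorphisms that commute with the action. -/
abbrev AutCommuting (β : G →* (LInfty μ ≃⋆ₐ[ℂ] LInfty μ)) :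
    Subgroup (LInfty μ ≃⋆ₐ[ℂ] LInfty μ) :=
  Subgroup.centralizer (Set.range β)

end LInfty

/-- The topology of pointwise convergence on the automorphism group of a discrete abelian group. -/
instance (H : Type*) [AddCommGroup H] : TopologicalSpace (AddAut H) :=
  TopologicalSpace.induced (fun φ (h : H) => φ h) (@Pi.topologicalSpace H (fun _ => H) fun _ => ⊥)

end BernoulliShift

end

/-! Pontryagin duality turns everything into Fourier analysis. Put Λ = Λ(H). The dual of Λ is a
compact group whose Haar measure has no atoms because Λ is infinite, so it is isomorphic to (X, μ)
modulo null sets. Its characters become unimodular functions e_a on X, closed under products and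
orthonormal with dense span in L². An operator commuting with multiplication by every e_a is
multiplication by a bounded function (`IsFourierSystem.exists_eq_mulOp`); hence the Fourier
transform carries L^∞(X) onto L(Λ) and the integral to the trace, and the shift becomes an action
with β_g(e_a) = e_{g·a}.

Ergodicity and freeness rest on square summability of Fourier coefficients. The coefficients of a
fixed function are constant on orbits, and translations push the support of any a ≠ 0 to infinity,
so only the coefficient at 0 survives. Where the point map of g ≠ 1 fixes x, all e_{g·a - a}(x)
equal 1; these are infinitely many characters, so such points form a null set.

Let α commute with the action and let d carry h at 0 and -h at (1,0). Shears fixing both points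
force the spectrum of α(e_d) to consist of functions supported on the first axis. Now use d + R·d =
D·d, where R and D carry the axis to the line x = 1 and to the diagonal. Axis and line meet in one
point, so an element of Λ splits in at most one way as a sum of pieces on them, and the convolution
α(e_d) α(e_{R·d}) has no cancellation. Since the sum must live on the diagonal, exactly one
coefficient of α(e_d) is nonzero, and it is idempotent: α(e_d) = e_{d'} with d' of the same shape
(`exists_apply_char_dif`). Such d and their translates under the action generate Λ, so α comes from
an endomorphism of H, and α⁻¹ supplies its inverse.

The automorphism α is not assumed to preserve the trace. The set function s ↦ ∫ α(1_s) dμ is a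
measure with the Fourier coefficients of μ, hence equals μ; so α is a 2-norm isometry determined by
its values on characters. Distinct characters lie at distance √2, which matches the two topologies.
-/

open MeasureTheory
open scoped ENNReal

noncomputable section

namespace BernoulliShift

/-! ### The *-algebra L^∞ and its 2-norm. -/

section LInftyBasics

variable {X : Type*} [MeasurableSpace X] {μ : Measure X}

theorem coeFn_mul (f g : LInfty μ) : ⇑(f * g) =ᵐ[μ] fun x => f x * g x :=
  Lp.coeFn_lpSMul (r := ∞) f g

theorem coeFn_star' (f : LInfty μ) : ⇑(star f) =ᵐ[μ] fun x => star (f x) :=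
  Lp.coeFn_star f

theorem linfty_mul_comm (f g : LInfty μ) : f * g = g * f := by
  apply Lp.ext
  filter_upwards [coeFn_mul f g, coeFn_mul g f] with x h1 h2
  rw [h1, h2, mul_comm]

theorem linfty_sub_mul (f g h : LInfty μ) : (f - g) * h = f * h - g * h := by
  apply Lp.ext
  filter_upwards [coeFn_mul f h, coeFn_mul g h, coeFn_mul (f - g) h, Lp.coeFn_sub f g,
    Lp.coeFn_sub (f * h) (g * h)] with x h1 h2 h3 h4 h5
  simp only [h3, h4, h5, Pi.sub_apply, h1, h2, sub_mul]

theorem linfty_ae_bound (f : LInfty μ) : ∀ᵐ x ∂μ, ‖f x‖ ≤ ‖f‖ := by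
  have h := ae_le_eLpNormEssSup (f := (f : X → ℂ)) (μ := μ)
  filter_upwards [h] with x hx
  have h2 : ‖f x‖ₑ ≤ ‖f‖ₑ := by
    rw [Lp.enorm_def, eLpNorm_exponent_top]; exact hx
  simpa [enorm_le_iff_norm_le] using h2

/-- A measurable bounded function as an element of `L^∞`. -/
def mkLInfty (f : X → ℂ) (hf : AEStronglyMeasurable f μ) (C : ℝ) (hC : ∀ᵐ x ∂μ, ‖f x‖ ≤ C) :
    LInfty μ :=
  (memLp_top_of_bound hf C hC).toLp f

theorem coeFn_mkLInfty (f : X → ℂ) (hf : AEStronglyMeasurable f μ) (C : ℝ)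
    (hC : ∀ᵐ x ∂μ, ‖f x‖ ≤ C) : ⇑(mkLInfty f hf C hC) =ᵐ[μ] f :=
  MemLp.coeFn_toLp _

variable [IsFiniteMeasure μ]

variable (μ) in
/-- The unit of `L^∞`. -/
def linftyOne : LInfty μ := Lp.const ∞ μ 1

theorem coeFn_linftyOne : ⇑(linftyOne μ) =ᵐ[μ] fun _ => 1 := Lp.coeFn_const _ _ _

theorem linftyOne_mul (f : LInfty μ) : linftyOne μ * f = f := by
  apply Lp.ext
  filter_upwards [coeFn_mul (linftyOne μ) f, coeFn_linftyOne (μ := μ)] with x h1 h2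
  rw [h1, h2, one_mul]

/-- Preservation of the unit is not part of a `≃⋆ₐ`; it follows from surjectivity, since α(1) acts
as a unit on the whole range. -/
theorem starAlgEquiv_linftyOne (α : LInfty μ ≃⋆ₐ[ℂ] LInfty μ) :
    α (linftyOne μ) = linftyOne μ := by
  have h : α (linftyOne μ) * α (α.symm (linftyOne μ)) = α (α.symm (linftyOne μ)) := by
    rw [← map_mul, linftyOne_mul]
  rw [StarAlgEquiv.apply_symm_apply] at h
  rw [linfty_mul_comm, linftyOne_mul] at h
  exact h

theorem integrable_linfty (f : LInfty μ) : Integrable f μ :=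
  (Lp.memLp f).integrable le_top

theorem coeFn_toL2 (f : LInfty μ) : ⇑(toL2 f) =ᵐ[μ] f := MemLp.coeFn_toLp _

/-- The inclusion `L^∞ ⊆ L²` as a linear map. -/
def toL2Linear : LInfty μ →ₗ[ℂ] Lp ℂ 2 μ where
  toFun := toL2
  map_add' f g := by
    apply Lp.ext
    filter_upwards [coeFn_toL2 (f + g), coeFn_toL2 f, coeFn_toL2 g, Lp.coeFn_add f g,
      Lp.coeFn_add (toL2 f) (toL2 g)] with x h1 h2 h3 h4 h5
    simp only [h1, h4, h5, Pi.add_apply, h2, h3]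
  map_smul' c f := by
    apply Lp.ext
    filter_upwards [coeFn_toL2 (c • f), coeFn_toL2 f, Lp.coeFn_smul c f,
      Lp.coeFn_smul c (toL2 f)] with x h1 h2 h3 h4
    simp only [RingHom.id_apply, h1, h3, h4, Pi.smul_apply, h2]

theorem toL2Linear_apply (f : LInfty μ) : toL2Linear f = toL2 f := rfl

theorem toL2_injective : Function.Injective (toL2 : LInfty μ → Lp ℂ 2 μ) := by
  intro f g h
  apply Lp.ext
  filter_upwards [coeFn_toL2 f, coeFn_toL2 g] with x h1 h2
  rw [← h1, ← h2, h]

theorem inner_toL2 (f g : LInfty μ) :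
    inner ℂ (toL2 f) (toL2 g) = ∫ x, (star f * g : LInfty μ) x ∂μ := by
  rw [L2.inner_def]
  apply integral_congr_ae
  filter_upwards [coeFn_toL2 f, coeFn_toL2 g, coeFn_mul (star f) g, coeFn_star' f]
    with x h1 h2 h3 h4
  rw [h1, h2, h3, h4]
  simp [mul_comm]

/-- The squared 2-norm of f is the integral of f* f, so multiplicativity, stars and integrals are
enough; linearity of T plays no role. -/
theorem norm_toL2_of_integral {T : LInfty μ → LInfty μ}
    (hmul : ∀ f g, T (f * g) = T f * T g) (hstar : ∀ f, T (star f) = star (T f))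
    (hT : ∀ f, ∫ x, (T f) x ∂μ = ∫ x, f x ∂μ) (f : LInfty μ) : ‖toL2 (T f)‖ = ‖toL2 f‖ := by
  have h : inner ℂ (toL2 (T f)) (toL2 (T f)) = inner ℂ (toL2 f) (toL2 f) := by
    rw [inner_toL2, inner_toL2, ← hstar, ← hmul, hT]
  rw [inner_self_eq_norm_sq_to_K, inner_self_eq_norm_sq_to_K] at h
  have h' : ‖toL2 (T f)‖ ^ 2 = ‖toL2 f‖ ^ 2 := by exact_mod_cast h
  exact (sq_eq_sq₀ (norm_nonneg _) (norm_nonneg _)).1 h'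

theorem integral_eq_inner_one (f : LInfty μ) :
    ∫ x, f x ∂μ = inner ℂ (toL2 (linftyOne μ)) (toL2 f) := by
  rw [inner_toL2]
  apply integral_congr_ae
  filter_upwards [coeFn_mul (star (linftyOne μ)) f, coeFn_star' (linftyOne μ),
    coeFn_linftyOne (μ := μ)] with x h1 h2 h3
  rw [h1, h2, h3]
  simp

end LInftyBasics

/-! ### Orthonormal systems of characters. -/

section FourierSystem

variable {X : Type*} [MeasurableSpace X] {μ : Measure X} [IsProbabilityMeasure μ]
  {L : Type*} [AddCommGroup L]

/-- A system of characters: a homomorphism from `L` to the unitary group of `L^∞(X, μ)` whose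
image is an orthonormal basis of `L²(X, μ)`. -/
structure IsFourierSystem (e : L → LInfty μ) : Prop where
  char_add : ∀ a b, e (a + b) = e a * e b
  char_neg : ∀ a, e (-a) = star (e a)
  char_zero : e 0 = linftyOne μ
  integral_eq_zero : ∀ a, a ≠ 0 → ∫ x, e a x ∂μ = 0
  dense : ⊤ ≤ (Submodule.span ℂ (Set.range fun a => toL2 (e a))).topologicalClosure

namespace IsFourierSystem

variable {e : L → LInfty μ} (he : IsFourierSystem e)
include he

theorem integral_zero : ∫ x, e 0 x ∂μ = 1 := by
  rw [he.char_zero, integral_congr_ae coeFn_linftyOne]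
  simp

/-- The inner product of e a and e b is the integral of the single character e (-a + b). -/
theorem orthonormal : Orthonormal ℂ fun a => toL2 (e a) := by
  classical
  rw [orthonormal_iff_ite]
  intro a b
  rw [inner_toL2, ← he.char_neg, ← he.char_add]
  split_ifs with h
  · rw [h, neg_add_cancel, he.integral_zero]
  · apply he.integral_eq_zero
    rwa [Ne, neg_add_eq_zero]

theorem injective : Function.Injective e := by
  intro a b h
  have := he.orthonormal.linearIndependent.injective
  exact this (congrArg toL2 h)

/-- Orthonormal vectors are √2 apart. The bound 1 suffices to read off equality of characters from
closeness in the 2-norm. -/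
theorem dist_of_ne {a b : L} (h : a ≠ b) : 1 < ‖toL2 (e a) - toL2 (e b)‖ := by
  have h1 : ‖toL2 (e a) - toL2 (e b)‖ ^ 2 = 2 := by
    have h0 := he.orthonormal
    rw [@norm_sub_sq ℂ, h0.1 a, h0.1 b, h0.2 h]
    norm_num
  nlinarith [norm_nonneg (toL2 (e a) - toL2 (e b))]

/-- The orthonormal basis of characters. -/
def basis : HilbertBasis L ℂ (Lp ℂ 2 μ) := HilbertBasis.mk he.orthonormal he.dense

theorem basis_apply (a : L) : he.basis a = toL2 (e a) := by
  rw [basis, HilbertBasis.coe_mk]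

theorem dense_toL2_span :
    Dense (toL2 '' (Submodule.span ℂ (Set.range e) : Set (LInfty μ))) := by
  have h : toL2 '' (Submodule.span ℂ (Set.range e) : Set (LInfty μ)) =
      (Submodule.span ℂ (Set.range fun a => toL2 (e a)) : Set (Lp ℂ 2 μ)) := by
    have h1 := Submodule.map_span (toL2Linear (μ := μ)) (Set.range e)
    rw [← Set.range_comp] at h1
    have h2 := congrArg (fun S : Submodule ℂ (Lp ℂ 2 μ) => (S : Set (Lp ℂ 2 μ))) h1
    exact h2
  rw [h, ← Submodule.dense_iff_topologicalClosure_eq_top.symm]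
  exact top_le_iff.1 he.dense

/-- Two additive maps that are isometric for the `2`-norm and agree on the characters are equal. -/
theorem eq_of_isometric (S T : LInfty μ →ₗ[ℂ] LInfty μ) (hS : ∀ f, ‖toL2 (S f)‖ = ‖toL2 f‖)
    (hT : ∀ f, ‖toL2 (T f)‖ = ‖toL2 f‖) (h : ∀ a, S (e a) = T (e a)) : S = T := by
  have hspan : ∀ p ∈ Submodule.span ℂ (Set.range e), S p = T p := by
    intro p hp
    exact LinearMap.eqOn_span (f := S) (g := T) (by rintro _ ⟨a, rfl⟩; exact h a) hp
  ext1 f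
  apply toL2_injective
  rw [← sub_eq_zero, ← norm_le_zero_iff]
  apply le_of_forall_pos_le_add
  intro ε hε
  obtain ⟨_, ⟨p, hp, rfl⟩, hpε⟩ := Metric.mem_closure_iff.1
    (he.dense_toL2_span (toL2 f)) (ε / 2) (by positivity)
  rw [dist_eq_norm] at hpε
  -- The span is dense only for the 2-norm. Both maps agree on p, so only the 2-norm small part f -
  -- p contributes, and isometry keeps it small.
  have e1 : toL2 (S f) - toL2 (T f) = toL2 (S (f - p)) - toL2 (T (f - p)) := by
    simp only [← toL2Linear_apply, map_sub, hspan p hp]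
    abel
  have e2 : ‖toL2 (f - p)‖ < ε / 2 := by
    rw [← toL2Linear_apply, map_sub]; exact hpε
  rw [e1]
  calc _ ≤ ‖toL2 (S (f - p))‖ + ‖toL2 (T (f - p))‖ := norm_sub_le _ _
    _ ≤ 0 + ε := by rw [hS, hT]; linarith

end IsFourierSystem

end FourierSystem

/-! ### Multiplication operators on L². -/

section Multiplication

variable {X : Type*} [MeasurableSpace X] {μ : Measure X}

/-- The operator of multiplication by `f ∈ L^∞` on `L²`. -/
def mulOp (f : LInfty μ) : Lp ℂ 2 μ →L[ℂ] Lp ℂ 2 μ :=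
  (ContinuousLinearMap.mul ℂ ℂ).holderL μ ∞ 2 2 f

theorem coeFn_mulOp (f : LInfty μ) (g : Lp ℂ 2 μ) : ⇑(mulOp f g) =ᵐ[μ] fun x => f x * g x :=
  (ContinuousLinearMap.mul ℂ ℂ).coeFn_holder (r := 2) f g

theorem mulOp_add (f g : LInfty μ) : mulOp (f + g) = mulOp f + mulOp g :=
  map_add ((ContinuousLinearMap.mul ℂ ℂ).holderL μ ∞ 2 2) f g

theorem mulOp_smul (c : ℂ) (f : LInfty μ) : mulOp (c • f) = c • mulOp f :=
  map_smul ((ContinuousLinearMap.mul ℂ ℂ).holderL μ ∞ 2 2) c f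

theorem mulOp_mul (f g : LInfty μ) : mulOp (f * g) = mulOp f * mulOp g := by
  ext1 h
  apply Lp.ext
  filter_upwards [coeFn_mulOp (f * g) h, coeFn_mulOp f (mulOp g h), coeFn_mulOp g h,
    coeFn_mul f g] with x h1 h2 h3 h4
  rw [h1, mul_apply_eq_comp, h2, h3, h4, mul_assoc]

theorem mulOp_star (f : LInfty μ) : mulOp (star f) = star (mulOp f) := by
  rw [ContinuousLinearMap.star_eq_adjoint, ContinuousLinearMap.eq_adjoint_iff]
  intro g h
  rw [L2.inner_def, L2.inner_def]
  apply integral_congr_ae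
  filter_upwards [coeFn_mulOp (star f) g, coeFn_mulOp f h, coeFn_star' f] with x h1 h2 h3
  rw [h1, h2, h3]
  simp
  ring

variable [IsFiniteMeasure μ]

theorem mulOp_toL2 (f g : LInfty μ) : mulOp f (toL2 g) = toL2 (f * g) := by
  apply Lp.ext
  filter_upwards [coeFn_mulOp f (toL2 g), coeFn_toL2 g, coeFn_toL2 (f * g), coeFn_mul f g]
    with x h1 h2 h3 h4
  rw [h1, h2, h3, h4]

theorem mulOp_toL2_one (f : LInfty μ) : mulOp f (toL2 (linftyOne μ)) = toL2 f := by
  rw [mulOp_toL2, linfty_mul_comm, linftyOne_mul]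

theorem mulOp_injective : Function.Injective (mulOp : LInfty μ → _) := by
  intro f g h
  apply toL2_injective
  rw [← mulOp_toL2_one f, h, mulOp_toL2_one]

/-- A function in `L²` that multiplies every `g ∈ L^∞` to a function of `2`-norm at most
`C ‖g‖₂` is bounded by `C`. -/
theorem ae_norm_le_of_mulOp_le (F : Lp ℂ 2 μ) (C : ℝ) (hC : 0 ≤ C)
    (h : ∀ g : LInfty μ, ‖mulOp g F‖ ≤ C * ‖toL2 g‖) : ∀ᵐ x ∂μ, ‖F x‖ ≤ C := by
  classical
  have hFm : Measurable fun x => ‖F x‖ := (Lp.stronglyMeasurable F).measurable.norm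
  set E : Set X := {x | C < ‖F x‖} with hE
  have hEm : MeasurableSet E := measurableSet_lt measurable_const hFm
  -- Test against the indicator of the exceptional set: the integral of |F|² - C² over E is then at
  -- most 0, although the integrand is positive on E.
  set q : LInfty μ := mkLInfty (E.indicator fun _ => 1)
    ((measurable_const.indicator hEm).aestronglyMeasurable) 1
    (.of_forall fun x => by by_cases hx : x ∈ E <;> simp [hx]) with hq
  have hqc : ⇑q =ᵐ[μ] E.indicator fun _ => 1 := coeFn_mkLInfty _ _ _ _
  have h1 : ‖mulOp q F‖ ^ 2 ≤ C ^ 2 * ‖toL2 q‖ ^ 2 := by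
    rw [← mul_pow]
    exact pow_le_pow_left₀ (norm_nonneg _) (h q) 2
  have nsq : ∀ G : Lp ℂ 2 μ, ‖G‖ ^ 2 = ∫ x, ‖G x‖ ^ 2 ∂μ := by
    intro G
    have := @inner_self_eq_norm_sq_to_K ℂ _ _ _ _ G
    rw [L2.inner_def] at this
    have h2 : ∀ x, inner ℂ (G x) (G x) = ((‖G x‖ ^ 2 : ℝ) : ℂ) := by
      intro x; rw [inner_self_eq_norm_sq_to_K]; push_cast; rfl
    simp_rw [h2, integral_complex_ofReal] at this
    exact (Complex.ofReal_injective (by rw [this]; push_cast; rfl))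
  have isq : ∀ G : Lp ℂ 2 μ, Integrable (fun x => ‖G x‖ ^ 2) μ := fun G =>
    (memLp_two_iff_integrable_sq_norm (Lp.memLp G).1).1 (Lp.memLp G)
  rw [nsq, nsq, ← integral_const_mul] at h1
  have h2 : ∫ x, (‖mulOp q F x‖ ^ 2 - C ^ 2 * ‖toL2 q x‖ ^ 2) ∂μ ≤ 0 := by
    rw [integral_sub (isq _) ((isq _).const_mul _)]
    linarith
  have h3 : (fun x => ‖mulOp q F x‖ ^ 2 - C ^ 2 * ‖toL2 q x‖ ^ 2) =ᵐ[μ]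
      E.indicator fun x => ‖F x‖ ^ 2 - C ^ 2 := by
    filter_upwards [coeFn_mulOp q F, coeFn_toL2 q, hqc] with x a b c
    rw [a, b, c]
    by_cases hx : x ∈ E <;> simp [hx]
  have h4 : 0 ≤ E.indicator fun x => ‖F x‖ ^ 2 - C ^ 2 := by
    intro x
    by_cases hx : x ∈ E
    · have : C < ‖F x‖ := hx
      simp only [Pi.zero_apply, Set.indicator_of_mem hx]
      nlinarith
    · simp [hx]
  have hi : Integrable (E.indicator fun x => ‖F x‖ ^ 2 - C ^ 2) μ :=
    ((isq _).sub ((isq _).const_mul _)).congr h3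
  rw [integral_congr_ae h3] at h2
  have h5 := (integral_eq_zero_iff_of_nonneg h4 hi).1 (le_antisymm h2 (integral_nonneg h4))
  filter_upwards [h5] with x hx
  by_contra hlt
  have hlt' : C < ‖F x‖ := not_le.1 hlt
  rw [Set.indicator_of_mem (show x ∈ E from hlt')] at hx
  simp only [Pi.zero_apply] at hx
  nlinarith

end Multiplication

/-! ### The Fourier transform from L^∞ onto the group von Neumann algebra. -/

namespace IsFourierSystem

variable {X : Type*} [MeasurableSpace X] {μ : Measure X} [IsProbabilityMeasure μ]
  {L : Type*} [AddCommGroup L] {e : L → LInfty μ} (he : IsFourierSystem e)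
include he

/-- An operator that commutes with multiplication by all characters is multiplication by a
bounded function. -/
theorem exists_eq_mulOp (T : Lp ℂ 2 μ →L[ℂ] Lp ℂ 2 μ)
    (hT : ∀ a, T * mulOp (e a) = mulOp (e a) * T) : ∃ f : LInfty μ, T = mulOp f := by
  -- The image of the constant 1 is the only possible symbol of T. It lies in L² at first; its
  -- boundedness is shown last.
  set F : Lp ℂ 2 μ := T (toL2 (linftyOne μ)) with hF
  have h1 : ∀ p ∈ Submodule.span ℂ (Set.range e), T (toL2 p) = mulOp p F := by
    intro p hp
    have := LinearMap.eqOn_span (s := Set.range e)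
      (f := T.toLinearMap ∘ₗ toL2Linear)
      (g := ((ContinuousLinearMap.mul ℂ ℂ).holderL μ ∞ 2 2).flip F) (by
        rintro _ ⟨a, rfl⟩
        change T (toL2 (e a)) = mulOp (e a) F
        have := DFunLike.congr_fun (hT a) (toL2 (linftyOne μ))
        simp only [mul_apply_eq_comp, mulOp_toL2_one] at this
        exact this) hp
    exact this
  -- As F is not yet known to be bounded, g ↦ g F cannot be extended by continuity in L². Instead
  -- one passes to a subsequence along which both u n and T (u n) converge almost everywhere.
  have h2 : ∀ g : Lp ℂ 2 μ, ⇑(T g) =ᵐ[μ] fun x => g x * F x := by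
    intro g
    obtain ⟨u, hu, hug⟩ := mem_closure_iff_seq_limit.1 (he.dense_toL2_span g)
    choose p hp hpu using hu
    have hTu : Filter.Tendsto (fun n => T (u n)) Filter.atTop (nhds (T g)) :=
      (T.continuous.tendsto g).comp hug
    obtain ⟨n1, hn1, hl1⟩ :=
      (tendstoInMeasure_of_tendsto_Lp hug).exists_seq_tendsto_ae
    obtain ⟨n2, hn2, hl2⟩ := (tendstoInMeasure_of_tendsto_Lp
      (hTu.comp hn1.tendsto_atTop)).exists_seq_tendsto_ae
    have hk : ∀ᵐ x ∂μ, ∀ n, T (u n) x = u n x * F x := by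
      rw [ae_all_iff]
      intro n
      rw [← hpu n, h1 _ (hp n)]
      filter_upwards [coeFn_mulOp (p n) F, coeFn_toL2 (p n)] with x a b
      rw [a, b]
    filter_upwards [hl1, hl2, hk] with x a b c
    have a' := (a.comp hn2.tendsto_atTop).mul_const (F x)
    refine tendsto_nhds_unique b (a'.congr fun n => ?_)
    simp only [Function.comp, c]
  have h3 : ∀ᵐ x ∂μ, ‖F x‖ ≤ ‖T‖ := by
    apply ae_norm_le_of_mulOp_le F _ (norm_nonneg _)
    intro g
    have : mulOp g F = T (toL2 g) := by
      apply Lp.ext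
      filter_upwards [h2 (toL2 g), coeFn_mulOp g F, coeFn_toL2 g] with x a b c
      rw [a, b, c]
    rw [this]
    exact T.le_opNorm _
  refine ⟨mkLInfty F (Lp.aestronglyMeasurable F) _ h3, ?_⟩
  ext1 g
  apply Lp.ext
  filter_upwards [h2 g, coeFn_mulOp (mkLInfty F (Lp.aestronglyMeasurable F) _ h3) g,
    coeFn_mkLInfty F (Lp.aestronglyMeasurable F) _ h3] with x a b c
  rw [a, b, c, mul_comm]

/-- Multiplication operators transported to `ℓ²` by the Fourier transform. -/
def conj : (Lp ℂ 2 μ →L[ℂ] Lp ℂ 2 μ) ≃⋆ₐ[ℂ] (ell2 L →L[ℂ] ell2 L) :=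
  he.basis.repr.conjStarAlgEquiv

theorem conj_apply_repr (T : Lp ℂ 2 μ →L[ℂ] Lp ℂ 2 μ) (g : Lp ℂ 2 μ) :
    he.conj T (he.basis.repr g) = he.basis.repr (T g) := by
  simp [conj, LinearIsometryEquiv.conjStarAlgEquiv_apply_apply]

/-- The adjoint of multiplication by e a is multiplication by e (-a), so the coefficient of e a · g
at i is the coefficient of g at -a + i. -/
theorem conj_mulOp_char (a : L) : he.conj (mulOp (e a)) = leftReg a := by
  ext1 v
  obtain ⟨g, rfl⟩ := he.basis.repr.surjective v
  rw [conj_apply_repr]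
  apply lp.ext
  funext i
  change _ = he.basis.repr g (-a + i)
  rw [HilbertBasis.repr_apply_apply, HilbertBasis.repr_apply_apply,
    ← ContinuousLinearMap.adjoint_inner_left, ← ContinuousLinearMap.star_eq_adjoint,
    ← mulOp_star, ← he.char_neg, he.basis_apply, he.basis_apply, mulOp_toL2, ← he.char_add]

/-- By `exists_eq_mulOp` the commutant of the regular representation consists of multiplication
operators, and these commute with one another. -/
theorem mulOp_mem (f : LInfty μ) : he.conj (mulOp f) ∈ (groupVN L).toStarSubalgebra := by
  refine (StarSubalgebra.mem_centralizer_iff ℂ).2 ?_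
  have key : ∀ y ∈ StarSubalgebra.centralizer ℂ (Set.range (leftReg (L := L))),
      y * he.conj (mulOp f) = he.conj (mulOp f) * y := by
    intro y hy
    obtain ⟨x, rfl⟩ := (show ∃ x, he.conj x = y from EquivLike.surjective he.conj y)
    obtain ⟨g, rfl⟩ := he.exists_eq_mulOp x (by
      intro a
      apply EquivLike.injective he.conj
      rw [map_mul, map_mul, he.conj_mulOp_char]
      exact (((StarSubalgebra.mem_centralizer_iff ℂ).1 hy _ ⟨a, rfl⟩).1).symm)
    rw [← map_mul, ← map_mul, ← mulOp_mul, ← mulOp_mul, linfty_mul_comm]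
  intro y hy
  exact ⟨key y hy, key _ (star_mem hy)⟩

theorem star_leftReg (a : L) : star (leftReg a) = leftReg (-a) := by
  rw [← he.conj_mulOp_char, ← he.conj_mulOp_char, he.char_neg, mulOp_star, map_star]

/-- As L is abelian, each `leftReg a` lies in the commutant of the regular representation. Hence x
commutes with all of them, and `exists_eq_mulOp` applies. -/
theorem exists_of_mem {x : ell2 L →L[ℂ] ell2 L} (hx : x ∈ (groupVN L).toStarSubalgebra) :
    ∃ f : LInfty μ, he.conj (mulOp f) = x := by
  obtain ⟨y, rfl⟩ := (show ∃ y, he.conj y = x from EquivLike.surjective he.conj x)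
  obtain ⟨f, rfl⟩ := he.exists_eq_mulOp y (by
    intro a
    apply EquivLike.injective he.conj
    rw [map_mul, map_mul, he.conj_mulOp_char]
    refine (((StarSubalgebra.mem_centralizer_iff ℂ).1 hx (leftReg a) ?_).1).symm
    refine (StarSubalgebra.mem_centralizer_iff ℂ).2 ?_
    have comm : ∀ b, leftReg b * leftReg a = leftReg a * leftReg b := by
      intro b
      rw [← he.conj_mulOp_char, ← he.conj_mulOp_char, ← map_mul, ← map_mul, ← mulOp_mul,
        ← mulOp_mul, linfty_mul_comm]
    rintro _ ⟨b, rfl⟩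
    refine ⟨comm b, ?_⟩
    rw [he.star_leftReg, comm])
  exact ⟨f, rfl⟩

/-- `L^∞(X, μ)` is isomorphic to the group von Neumann algebra, by the Fourier transform. -/
def equivVN : LInfty μ ≃⋆ₐ[ℂ] (groupVN L).toStarSubalgebra where
  toEquiv := Equiv.ofBijective (fun f => ⟨he.conj (mulOp f), he.mulOp_mem f⟩)
    ⟨fun f g h => mulOp_injective (EquivLike.injective he.conj (congrArg Subtype.val h)),
      fun x => (he.exists_of_mem x.2).imp fun f hf => Subtype.ext hf⟩
  map_mul' f g := Subtype.ext (by
    change he.conj (mulOp (f * g)) = he.conj (mulOp f) * he.conj (mulOp g)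
    rw [mulOp_mul, map_mul])
  map_add' f g := Subtype.ext (by
    change he.conj (mulOp (f + g)) = he.conj (mulOp f) + he.conj (mulOp g)
    rw [mulOp_add]
    exact he.conj.map_add' (mulOp f) (mulOp g))
  map_star' f := Subtype.ext (by
    change he.conj (mulOp (star f)) = star (he.conj (mulOp f))
    rw [mulOp_star, map_star])
  map_smul' c f := Subtype.ext (by
    change he.conj (mulOp (c • f)) = c • he.conj (mulOp f)
    rw [mulOp_smul]
    exact he.conj.map_smul' c (mulOp f))

theorem equivVN_coe (f : LInfty μ) : (he.equivVN f).1 = he.conj (mulOp f) := rfl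

theorem equivVN_char (a : L) : he.equivVN (e a) = ⟨leftReg a, leftReg_mem a⟩ :=
  Subtype.ext (he.conj_mulOp_char a)

theorem equivVN_symm_leftReg (a : L) : he.equivVN.symm ⟨leftReg a, leftReg_mem a⟩ = e a := by
  rw [← he.equivVN_char, StarAlgEquiv.symm_apply_apply]

theorem delta0_eq : delta0 L = he.basis.repr (toL2 (linftyOne μ)) := by
  classical
  rw [← he.char_zero, ← he.basis_apply, HilbertBasis.repr_self, delta0]

theorem canonicalTrace_equivVN (f : LInfty μ) : canonicalTrace (he.equivVN f) = ∫ x, f x ∂μ := by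
  rw [canonicalTrace, equivVN_coe, he.delta0_eq, conj_apply_repr, LinearIsometryEquiv.inner_map_map,
    mulOp_toL2_one, integral_eq_inner_one]

end IsFourierSystem

theorem permUnitary_delta0 {L : Type*} [AddCommGroup L] (σ : Equiv.Perm L) (h : σ 0 = 0) :
    (permUnitary σ : ell2 L →L[ℂ] ell2 L) (delta0 L) = delta0 L := by
  classical
  apply lp.ext
  funext i
  change (delta0 L) (σ.symm i) = delta0 L i
  have hs : ∀ i, (delta0 L) i = if i = 0 then 1 else 0 := by
    intro i
    rw [delta0, lp.single_apply]
    simp [Pi.single_apply]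
  rw [hs, hs]
  have : σ.symm i = 0 ↔ i = 0 := by rw [Equiv.symm_apply_eq, h]
  simp only [this]

/-- The unitary fixes δ_0, and so does its adjoint; conjugation therefore preserves the vector state
at δ_0. -/
theorem inner_conj_delta0 {L : Type*} [AddCommGroup L] (σ : Equiv.Perm L) (h : σ 0 = 0)
    (x : ell2 L →L[ℂ] ell2 L) :
    inner ℂ (delta0 L) (((permUnitary σ).1 * x * star (permUnitary σ).1) (delta0 L)) =
      inner ℂ (delta0 L) (x (delta0 L)) := by
  have h1 : star (permUnitary σ).1 (delta0 L) = delta0 L := by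
    conv_lhs => rw [← permUnitary_delta0 σ h]
    rw [← mul_apply_eq_comp, Unitary.star_mul_self_of_mem (permUnitary σ).2]
    rfl
  rw [mul_apply_eq_comp, mul_apply_eq_comp, h1,
    ← ContinuousLinearMap.adjoint_inner_left, ← ContinuousLinearMap.star_eq_adjoint, h1]

/-- Group automorphisms as permutations. -/
def addAutPerm (L : Type*) [AddCommGroup L] : Multiplicative (AddAut L) →* Equiv.Perm L where
  toFun σ := σ.toAdd.toEquiv
  map_one' := rfl
  map_mul' _ _ := rfl

theorem permUnitary_conj_leftReg {L : Type*} [AddCommGroup L] (σ : Multiplicative (AddAut L))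
    (a : L) : Unitary.conjStarAlgAut ℂ _ (permUnitary (addAutPerm L σ)) (leftReg a) =
      leftReg (σ.toAdd a) := by
  have key : addAutPerm L σ * Equiv.addLeft a =
      Equiv.addLeft (σ.toAdd a) * addAutPerm L σ := by
    ext1 b
    exact σ.toAdd.map_add a b
  have h := congrArg Subtype.val (congrArg (permUnitary (ι := L)) key)
  rw [map_mul, map_mul] at h
  change (permUnitary (addAutPerm L σ)).1 * leftReg a =
    leftReg (σ.toAdd a) * (permUnitary (addAutPerm L σ)).1 at h
  rw [Unitary.conjStarAlgAut_apply, h, mul_assoc,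
    Unitary.mul_star_self_of_mem (permUnitary _).2, mul_one]

theorem permUnitary_conj_mem {L : Type*} [AddCommGroup L] (σ : Multiplicative (AddAut L))
    (x : ell2 L →L[ℂ] ell2 L) (hx : x ∈ (groupVN L).toStarSubalgebra) :
    Unitary.conjStarAlgAut ℂ _ (permUnitary (addAutPerm L σ)) x ∈
      (groupVN L).toStarSubalgebra := by
  let ρ := (Unitary.conjStarAlgAut ℂ (ell2 L →L[ℂ] ell2 L)).comp
    (permUnitary.comp (addAutPerm L))
  refine centralizer_invariant ρ _ ?_ σ x hx
  refine centralizer_invariant ρ _ ?_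
  rintro g _ ⟨a, rfl⟩
  exact ⟨g.toAdd a, (permUnitary_conj_leftReg g a).symm⟩

namespace IsFourierSystem

variable {X : Type*} [MeasurableSpace X] {μ : Measure X} [IsProbabilityMeasure μ]
  {L : Type*} [AddCommGroup L] {e : L → LInfty μ} (he : IsFourierSystem e)
include he

/-- Every automorphism of the group `L` is realized by a trace preserving automorphism of
`L^∞(X, μ)`. -/
theorem exists_starAlgEquiv (σ : L ≃+ L) : ∃ α : LInfty μ ≃⋆ₐ[ℂ] LInfty μ,
    (∀ a, α (e a) = e (σ a)) ∧ ∀ f, ∫ x, (α f : LInfty μ) x ∂μ = ∫ x, f x ∂μ := by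
  let A := restrictAction (groupVN L).toStarSubalgebra
    ((Unitary.conjStarAlgAut ℂ (ell2 L →L[ℂ] ell2 L)).comp (permUnitary.comp (addAutPerm L)))
    permUnitary_conj_mem (Multiplicative.ofAdd σ)
  refine ⟨(he.equivVN.trans A).trans he.equivVN.symm, fun a => ?_, fun f => ?_⟩
  · change he.equivVN.symm (A (he.equivVN (e a))) = _
    rw [he.equivVN_char, ← he.equivVN_symm_leftReg]
    congr 1
    exact Subtype.ext (permUnitary_conj_leftReg (Multiplicative.ofAdd σ) a)
  · change ∫ x, (he.equivVN.symm (A (he.equivVN f)) : LInfty μ) x ∂μ = _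
    rw [← he.canonicalTrace_equivVN, StarAlgEquiv.apply_symm_apply, ← he.canonicalTrace_equivVN]
    exact inner_conj_delta0 (addAutPerm L (Multiplicative.ofAdd σ)) (map_zero σ) _

end IsFourierSystem

/-! ### The measure s ↦ ∫ α(1_s) dμ of an arbitrary *-automorphism α. -/

section PullbackMeasure

variable {X : Type*} [MeasurableSpace X] {μ : Measure X} [IsProbabilityMeasure μ]

variable (μ) in
/-- The indicator function of a measurable set in `L^∞`. -/
def indL {s : Set X} (hs : MeasurableSet s) : LInfty μ :=
  indicatorConstLp ∞ hs (measure_ne_top μ s) 1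

theorem coeFn_indL {s : Set X} (hs : MeasurableSet s) :
    ⇑(indL μ hs) =ᵐ[μ] s.indicator fun _ => 1 := indicatorConstLp_coeFn

theorem indL_mul {s t : Set X} (hs : MeasurableSet s) (ht : MeasurableSet t) :
    indL μ hs * indL μ ht = indL μ (hs.inter ht) := by
  apply Lp.ext
  filter_upwards [coeFn_mul (indL μ hs) (indL μ ht), coeFn_indL (μ := μ) hs,
    coeFn_indL (μ := μ) ht, coeFn_indL (μ := μ) (hs.inter ht)] with x h1 h2 h3 h4
  rw [h1, h2, h3, h4]
  by_cases a : x ∈ s <;> by_cases b : x ∈ t <;> simp [a, b]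

theorem indL_congr {s t : Set X} (hs : MeasurableSet s) (ht : MeasurableSet t)
    (h : s =ᵐ[μ] t) : indL μ hs = indL μ ht := by
  apply Lp.ext
  exact (coeFn_indL hs).trans ((indicator_ae_eq_of_ae_eq_set h).trans (coeFn_indL ht).symm)

theorem indL_eq_zero {s : Set X} (hs : MeasurableSet s) (h : μ s = 0) : indL μ hs = 0 := by
  rw [indL_congr hs MeasurableSet.empty (ae_eq_empty.2 h)]
  exact indicatorConstLp_empty

/-- The set whose indicator function is the image of the indicator function of `s`. -/
def imageSet (α : LInfty μ ≃⋆ₐ[ℂ] LInfty μ) {s : Set X} (hs : MeasurableSet s) : Set X :=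
  {x | (α (indL μ hs) : LInfty μ) x = 1}

variable (α : LInfty μ ≃⋆ₐ[ℂ] LInfty μ)

theorem measurableSet_imageSet {s : Set X} (hs : MeasurableSet s) :
    MeasurableSet (imageSet α hs) :=
  (Lp.stronglyMeasurable (α (indL μ hs) : LInfty μ)).measurable (measurableSet_singleton 1)

/-- The image of an indicator is idempotent, so almost everywhere it takes only the values 0 and 1.
-/
theorem apply_indL {s : Set X} (hs : MeasurableSet s) :
    ⇑(α (indL μ hs) : LInfty μ) =ᵐ[μ] (imageSet α hs).indicator fun _ => 1 := by
  have h : α (indL μ hs) * α (indL μ hs) = α (indL μ hs) := by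
    rw [← map_mul, indL_mul]
    congr 2
    exact Set.inter_self s
  have h2 := coeFn_mul (α (indL μ hs)) (α (indL μ hs))
  rw [h] at h2
  filter_upwards [h2] with x hx
  by_cases hm : x ∈ imageSet α hs
  · rw [Set.indicator_of_mem hm]; exact hm
  · rw [Set.indicator_of_notMem hm]
    have hm' : (α (indL μ hs) : LInfty μ) x ≠ 1 := hm
    by_contra h0
    exact hm' (mul_left_cancel₀ h0 (by rw [← hx, mul_one]))

theorem measure_imageSet_of_null {s : Set X} (hs : MeasurableSet s) (h : μ s = 0) :
    μ (imageSet α hs) = 0 := by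
  have h1 : (α (indL μ hs) : LInfty μ) = 0 := by rw [indL_eq_zero hs h, map_zero]
  have h2 : ∀ᵐ x ∂μ, x ∉ imageSet α hs := by
    filter_upwards [Lp.coeFn_zero ℂ ∞ μ] with x hx hm
    have hm' : (α (indL μ hs) : LInfty μ) x = 1 := hm
    rw [h1, hx] at hm'
    simp at hm'
  simpa [ae_iff] using h2

theorem aedisjoint_imageSet {s t : Set X} (hs : MeasurableSet s) (ht : MeasurableSet t)
    (h : Disjoint s t) : AEDisjoint μ (imageSet α hs) (imageSet α ht) := by
  have h1 : α (indL μ hs) * α (indL μ ht) = 0 := by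
    rw [← map_mul, indL_mul, indL_eq_zero _ (by rw [h.inter_eq, measure_empty]), map_zero]
  have h2 := coeFn_mul (α (indL μ hs)) (α (indL μ ht))
  rw [h1] at h2
  have h3 : ∀ᵐ x ∂μ, x ∉ imageSet α hs ∩ imageSet α ht := by
    filter_upwards [h2, Lp.coeFn_zero ℂ ∞ μ] with x hx h0 hm
    have hm1 : (α (indL μ hs) : LInfty μ) x = 1 := hm.1
    have hm2 : (α (indL μ ht) : LInfty μ) x = 1 := hm.2
    rw [h0, hm1, hm2] at hx
    simp at hx
  rw [AEDisjoint]
  simpa [ae_iff] using h3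

/-- Countable additivity without any continuity of α. Let U be the union, P the union of the image
sets and R = α(1_U) - 1_P. Then R annihilates each α(1_{f i}), so α⁻¹(R) vanishes on every f i,
hence on U, and R annihilates α(1_U). This gives α(1_U) ≤ 1_P; the other inequality holds for each i
separately. -/
theorem imageSet_iUnion {f : ℕ → Set X} (hf : ∀ i, MeasurableSet (f i)) :
    imageSet α (MeasurableSet.iUnion hf) =ᵐ[μ] ⋃ i, imageSet α (hf i) := by
  have hP := MeasurableSet.iUnion fun i => measurableSet_imageSet α (hf i)
  set hU := MeasurableSet.iUnion hf
  have hQp : ∀ i, α (indL μ hU) * α (indL μ (hf i)) = α (indL μ (hf i)) := by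
    intro i
    rw [← map_mul, indL_mul]
    congr 2
    exact Set.inter_eq_right.2 (Set.subset_iUnion f i)
  have hPp : ∀ i, indL μ hP * α (indL μ (hf i)) = α (indL μ (hf i)) := by
    intro i
    apply Lp.ext
    filter_upwards [coeFn_mul (indL μ hP) (α (indL μ (hf i))), coeFn_indL (μ := μ) hP,
      apply_indL α (hf i)] with x h1 h2 h3
    rw [h1, h2, h3]
    by_cases hx : x ∈ imageSet α (hf i)
    · rw [Set.indicator_of_mem hx, Set.indicator_of_mem (Set.mem_iUnion.2 ⟨i, hx⟩), mul_one]
    · rw [Set.indicator_of_notMem hx, mul_zero]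
  have hQQ : α (indL μ hU) * α (indL μ hU) = α (indL μ hU) := by
    rw [← map_mul, indL_mul]
    congr 2
    exact Set.inter_self _
  set R : LInfty μ := α (indL μ hU) - indL μ hP with hR
  have hRp : ∀ i, α.symm R * indL μ (hf i) = 0 := by
    intro i
    apply EquivLike.injective α
    rw [map_mul, map_zero, StarAlgEquiv.apply_symm_apply, hR, linfty_sub_mul, hQp, hPp, sub_self]
  have hRU : α.symm R * indL μ hU = 0 := by
    apply Lp.ext
    have hk : ∀ᵐ x ∂μ, ∀ i, x ∈ f i → (α.symm R : LInfty μ) x = 0 := by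
      rw [ae_all_iff]
      intro i
      have := coeFn_mul (α.symm R) (indL μ (hf i))
      rw [hRp] at this
      filter_upwards [this, coeFn_indL (μ := μ) (hf i), Lp.coeFn_zero ℂ ∞ μ]
        with x h1 h2 h3 hx
      rw [h2, h3, Set.indicator_of_mem hx, mul_one] at h1
      exact h1.symm
    filter_upwards [coeFn_mul (α.symm R) (indL μ hU), coeFn_indL (μ := μ) hU,
      Lp.coeFn_zero ℂ ∞ μ, hk] with x h1 h2 h3 h4
    rw [h1, h2, h3]
    by_cases hx : x ∈ ⋃ i, f i
    · obtain ⟨i, hi⟩ := Set.mem_iUnion.1 hx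
      rw [h4 i hi, zero_mul]; rfl
    · rw [Set.indicator_of_notMem hx, mul_zero]; rfl
  have hRQ : R * α (indL μ hU) = 0 := by
    have := congrArg α hRU
    rwa [map_mul, map_zero, StarAlgEquiv.apply_symm_apply] at this
  rw [hR, linfty_sub_mul, hQQ, sub_eq_zero] at hRQ
  have hk : ∀ᵐ x ∂μ, ∀ i, x ∈ imageSet α (hf i) → (α (indL μ hU) : LInfty μ) x = 1 := by
    rw [ae_all_iff]
    intro i
    have := coeFn_mul (α (indL μ hU)) (α (indL μ (hf i)))
    rw [hQp] at this
    filter_upwards [this] with x h1 hx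
    have hx' : (α (indL μ (hf i)) : LInfty μ) x = 1 := hx
    rw [hx', mul_one] at h1
    exact h1.symm
  have h5 := coeFn_mul (indL μ hP) (α (indL μ hU))
  rw [← hRQ] at h5
  apply Filter.Eventually.set_eq
  filter_upwards [hk, h5, coeFn_indL (μ := μ) hP] with x h1 h2 h3
  constructor
  · intro hx
    have hx' : (α (indL μ hU) : LInfty μ) x = 1 := hx
    by_contra hn
    rw [hx', h3, Set.indicator_of_notMem hn] at h2
    simp at h2
  · intro hx
    obtain ⟨i, hi⟩ := Set.mem_iUnion.1 hx
    exact h1 i hi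

/-- The measure `s ↦ ∫ α(1_s) dμ`. -/
def pullbackMeasure : Measure X :=
  Measure.ofMeasurable (fun _ hs => μ (imageSet α hs))
    (measure_imageSet_of_null α MeasurableSet.empty measure_empty)
    (fun f hf hd => by
      rw [measure_congr (imageSet_iUnion α hf)]
      exact measure_iUnion₀ (fun i j hij => aedisjoint_imageSet α (hf i) (hf j) (hd hij))
        fun i => (measurableSet_imageSet α (hf i)).nullMeasurableSet)

theorem pullbackMeasure_apply {s : Set X} (hs : MeasurableSet s) :
    pullbackMeasure α s = μ (imageSet α hs) := Measure.ofMeasurable_apply s hs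

instance : IsFiniteMeasure (pullbackMeasure α) :=
  ⟨by rw [pullbackMeasure_apply α MeasurableSet.univ]; exact measure_lt_top _ _⟩

theorem pullbackMeasure_absolutelyContinuous : pullbackMeasure α ≪ μ :=
  Measure.AbsolutelyContinuous.mk fun _ hs h => by
    rw [pullbackMeasure_apply α hs, measure_imageSet_of_null α hs h]

/-- The bound |f| ≤ C is algebraic: it says that C² = f* f + g* g with g = √(C² - |f|²), and α
preserves this identity. -/
theorem ae_norm_apply_le {f : LInfty μ} {C : ℝ} (hC : 0 ≤ C) (h : ∀ᵐ x ∂μ, ‖f x‖ ≤ C) :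
    ∀ᵐ x ∂μ, ‖(α f : LInfty μ) x‖ ≤ C := by
  have hm : Measurable fun x => ((Real.sqrt (C ^ 2 - ‖f x‖ ^ 2) : ℝ) : ℂ) :=
    Complex.measurable_ofReal.comp
      ((measurable_const.sub ((Lp.stronglyMeasurable f).measurable.norm.pow_const 2)).sqrt)
  have hb : ∀ᵐ x ∂μ, ‖((Real.sqrt (C ^ 2 - ‖f x‖ ^ 2) : ℝ) : ℂ)‖ ≤ C := by
    refine .of_forall fun x => ?_
    rw [Complex.norm_real, Real.norm_of_nonneg (Real.sqrt_nonneg _)]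
    exact Real.sqrt_le_iff.2 ⟨hC, by nlinarith [sq_nonneg ‖f x‖]⟩
  set g : LInfty μ := mkLInfty _ hm.aestronglyMeasurable C hb with hg
  have key : star f * f + star g * g = ((C ^ 2 : ℝ) : ℂ) • linftyOne μ := by
    apply Lp.ext
    filter_upwards [Lp.coeFn_add (star f * f) (star g * g), coeFn_mul (star f) f,
      coeFn_mul (star g) g, coeFn_star' f, coeFn_star' g, coeFn_mkLInfty _ hm.aestronglyMeasurable C hb,
      Lp.coeFn_smul ((C ^ 2 : ℝ) : ℂ) (linftyOne μ), coeFn_linftyOne (μ := μ), h]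
      with x h1 h2 h3 h4 h5 h6 h7 h8 h9
    rw [h1, h7, Pi.add_apply, Pi.smul_apply, h2, h3, h4, h5, h6, h8]
    have e1 : ∀ z : ℂ, star z * z = ((‖z‖ ^ 2 : ℝ) : ℂ) := fun z => by
      rw [mul_comm, Complex.star_def, Complex.mul_conj, Complex.normSq_eq_norm_sq]
    rw [e1, e1, Complex.norm_real, Real.norm_of_nonneg (Real.sqrt_nonneg _), Real.sq_sqrt (by
      have := pow_le_pow_left₀ (norm_nonneg _) h9 2; linarith)]
    rw [← Complex.ofReal_add]
    simp
  have key2 := congrArg α key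
  rw [map_add, map_mul, map_mul, map_star, map_star, map_smul, starAlgEquiv_linftyOne] at key2
  have h0 := Lp.coeFn_add (star (α f) * (α f)) (star (α g) * (α g))
  rw [key2] at h0
  filter_upwards [h0, coeFn_mul (star (α f)) (α f),
      coeFn_mul (star (α g)) (α g), coeFn_star' (α f), coeFn_star' (α g),
      Lp.coeFn_smul ((C ^ 2 : ℝ) : ℂ) (linftyOne μ), coeFn_linftyOne (μ := μ)]
      with x h1 h2 h3 h4 h5 h7 h8
  rw [h7, Pi.add_apply, Pi.smul_apply, h2, h3, h4, h5, h8] at h1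
  have e1 : ∀ z : ℂ, star z * z = ((‖z‖ ^ 2 : ℝ) : ℂ) := fun z => by
    rw [mul_comm, Complex.star_def, Complex.mul_conj, Complex.normSq_eq_norm_sq]
  rw [e1, e1, smul_eq_mul, mul_one, ← Complex.ofReal_add] at h1
  have h9 := Complex.ofReal_injective h1
  exact abs_le_of_sq_le_sq' (by nlinarith [sq_nonneg ‖(α g : LInfty μ) x‖]) hC |>.2

end PullbackMeasure

/-- Bounded measurable functions are uniform limits of simple functions. -/
theorem exists_simpleFunc_norm_sub_le {X : Type*} [MeasurableSpace X] {f : X → ℂ}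
    (hf : Measurable f) (C : ℝ) {ε : ℝ} (hε : 0 < ε) :
    ∃ s : SimpleFunc X ℂ, ∀ x, ‖f x‖ ≤ C → ‖f x - s x‖ ≤ 2 * ε := by
  classical
  -- Clamp to [-C, C], then round down to a multiple of ε; clamping makes the range finite. Real and
  -- imaginary parts each lose at most ε, which gives 2ε.
  let t : ℝ → ℝ := fun r => ε * ⌊(max (-C) (min C r)) / ε⌋
  have ht : Measurable t :=
    measurable_const.mul (measurable_from_top.comp
      (Int.measurable_floor.comp ((measurable_const.max (measurable_const.min measurable_id)).div_const ε)))
  have htf : (Set.range t).Finite := by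
    refine ((Set.finite_Icc ⌊-C / ε⌋ ⌊(max (-C) C) / ε⌋).image fun k : ℤ => ε * (k : ℝ)).subset ?_
    rintro _ ⟨r, rfl⟩
    refine ⟨_, ⟨Int.floor_le_floor ?_, Int.floor_le_floor ?_⟩, rfl⟩
    · gcongr; exact le_max_left _ _
    · gcongr; exact min_le_left _ _
  have hta : ∀ r, |r| ≤ C → |r - t r| ≤ ε := by
    intro r hr
    obtain ⟨h1, h2⟩ := abs_le.1 hr
    have h3 : t r = ε * ⌊r / ε⌋ := by
      simp only [t]; rw [min_eq_right h2, max_eq_right h1]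
    rw [h3]
    have h4 := Int.floor_le (r / ε)
    have h5 := Int.lt_floor_add_one (r / ε)
    have h6 : ε * (r / ε) = r := by field_simp
    rw [abs_le]
    constructor <;> nlinarith
  let g : X → ℂ := fun x => (t (f x).re : ℂ) + (t (f x).im : ℂ) * Complex.I
  have hg : Measurable g :=
    (Complex.measurable_ofReal.comp (ht.comp (Complex.measurable_re.comp hf))).add
      ((Complex.measurable_ofReal.comp (ht.comp (Complex.measurable_im.comp hf))).mul_const _)
  have hgf : (Set.range g).Finite := by
    refine ((htf.prod htf).image fun p : ℝ × ℝ => (p.1 : ℂ) + (p.2 : ℂ) * Complex.I).subset ?_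
    rintro _ ⟨x, rfl⟩
    exact ⟨(t (f x).re, t (f x).im), ⟨⟨_, rfl⟩, ⟨_, rfl⟩⟩, rfl⟩
  refine ⟨⟨g, fun z => hg (measurableSet_singleton z), hgf⟩, fun x hx => ?_⟩
  change ‖f x - g x‖ ≤ _
  refine (Complex.norm_le_abs_re_add_abs_im _).trans ?_
  have h1 := hta _ ((Complex.abs_re_le_norm (f x)).trans hx)
  have h2 := hta _ ((Complex.abs_im_le_norm (f x)).trans hx)
  have e1 : (f x - g x).re = (f x).re - t (f x).re := by simp [g]
  have e2 : (f x - g x).im = (f x).im - t (f x).im := by simp [g]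
  rw [e1, e2]
  linarith

section Integral

variable {X : Type*} [MeasurableSpace X] {μ : Measure X} [IsProbabilityMeasure μ]
  (α : LInfty μ ≃⋆ₐ[ℂ] LInfty μ)

theorem integral_apply_simpleFunc (s : SimpleFunc X ℂ) :
    ∀ f : LInfty μ, f =ᵐ[μ] s → ∫ x, (α f : LInfty μ) x ∂μ = ∫ x, s x ∂(pullbackMeasure α) := by
  classical
  induction s using SimpleFunc.induction with
  | @const c s hs =>
    intro f hf
    have e1 : f = c • indL μ hs := by
      apply Lp.ext
      filter_upwards [hf, Lp.coeFn_smul c (indL μ hs), coeFn_indL (μ := μ) hs] with x h1 h2 h3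
      rw [h1, h2, Pi.smul_apply, h3]
      by_cases hx : x ∈ s <;> simp [hx]
    have e2 : ⇑(α f : LInfty μ) =ᵐ[μ] (imageSet α hs).indicator fun _ => c := by
      rw [e1, map_smul]
      filter_upwards [Lp.coeFn_smul c (α (indL μ hs)), apply_indL α hs] with x h1 h2
      rw [h1, Pi.smul_apply, h2]
      by_cases hx : x ∈ imageSet α hs <;> simp [hx]
    rw [integral_congr_ae e2, integral_indicator_const _ (measurableSet_imageSet α hs)]
    have e3 : ⇑(SimpleFunc.piecewise s hs (SimpleFunc.const X c) (SimpleFunc.const X 0)) =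
        s.indicator fun _ => c := by
      funext x
      by_cases hx : x ∈ s <;> simp [hx]
    rw [e3, integral_indicator_const _ hs, measureReal_def, measureReal_def,
      pullbackMeasure_apply α hs]
  | @add s t hd hs ht =>
    intro f hf
    obtain ⟨Cs, hCs⟩ := s.exists_forall_norm_le
    obtain ⟨Ct, hCt⟩ := t.exists_forall_norm_le
    let fs : LInfty μ := mkLInfty s s.measurable.aestronglyMeasurable Cs (.of_forall hCs)
    let ft : LInfty μ := mkLInfty t t.measurable.aestronglyMeasurable Ct (.of_forall hCt)
    have hfs : ⇑fs =ᵐ[μ] s := coeFn_mkLInfty _ _ _ _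
    have hft : ⇑ft =ᵐ[μ] t := coeFn_mkLInfty _ _ _ _
    have e1 : f = fs + ft := by
      apply Lp.ext
      filter_upwards [hf, hfs, hft, Lp.coeFn_add fs ft] with x h1 h2 h3 h4
      rw [h1, h4, Pi.add_apply, h2, h3]
      rfl
    rw [e1, map_add, integral_congr_ae (Lp.coeFn_add (α fs) (α ft))]
    simp only [Pi.add_apply, SimpleFunc.coe_add]
    rw [integral_add (integrable_linfty _) (integrable_linfty _), hs fs hfs, ht ft hft,
      integral_add (SimpleFunc.integrable_of_isFiniteMeasure s)
        (SimpleFunc.integrable_of_isFiniteMeasure t)]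

/-- The two sides agree on simple functions, and both are continuous for uniform approximation: the
right side because the measure is finite, the left side by `ae_norm_apply_le`. -/
theorem integral_apply (f : LInfty μ) :
    ∫ x, (α f : LInfty μ) x ∂μ = ∫ x, f x ∂(pullbackMeasure α) := by
  have hac := pullbackMeasure_absolutelyContinuous α
  set ν := pullbackMeasure α
  have hfν : Integrable (⇑f) ν :=
    Integrable.of_bound (Lp.stronglyMeasurable f).aestronglyMeasurable ‖f‖
      (hac.ae_le (linfty_ae_bound f))
  rw [← sub_eq_zero, ← norm_le_zero_iff]
  have hstep : ∀ ε > 0, ‖∫ x, (α f : LInfty μ) x ∂μ - ∫ x, f x ∂ν‖ ≤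
      2 * ε * (1 + ν.real Set.univ) := by
    intro ε hε
    obtain ⟨s, hs⟩ := exists_simpleFunc_norm_sub_le (Lp.stronglyMeasurable f).measurable ‖f‖ hε
    obtain ⟨C, hC⟩ := s.exists_forall_norm_le
    let fs : LInfty μ := mkLInfty s s.measurable.aestronglyMeasurable C (.of_forall hC)
    have hfs : ⇑fs =ᵐ[μ] s := coeFn_mkLInfty _ _ _ _
    have e1 := integral_apply_simpleFunc α s fs hfs
    have b1 : ∀ᵐ x ∂μ, ‖(f - fs : LInfty μ) x‖ ≤ 2 * ε := by
      filter_upwards [linfty_ae_bound f, hfs, Lp.coeFn_sub f fs] with x h1 h2 h3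
      rw [h3, Pi.sub_apply, h2]
      exact hs x h1
    have b2 : ‖∫ x, (α (f - fs) : LInfty μ) x ∂μ‖ ≤ 2 * ε := by
      have := norm_integral_le_of_norm_le_const (ae_norm_apply_le α (by positivity) b1)
      simpa using this
    have b3 : ‖∫ x, (f x - s x) ∂ν‖ ≤ 2 * ε * ν.real Set.univ := by
      apply norm_integral_le_of_norm_le_const
      filter_upwards [hac.ae_le (linfty_ae_bound f)] with x h1
      exact hs x h1
    rw [integral_sub hfν (SimpleFunc.integrable_of_isFiniteMeasure s)] at b3
    rw [map_sub, integral_congr_ae (Lp.coeFn_sub (α f) (α fs))] at b2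
    simp only [Pi.sub_apply] at b2
    rw [integral_sub (integrable_linfty _) (integrable_linfty _), e1] at b2
    calc _ = ‖(∫ x, (α f : LInfty μ) x ∂μ - ∫ x, s x ∂ν) - (∫ x, f x ∂ν - ∫ x, s x ∂ν)‖ := by
          congr 1; ring
      _ ≤ 2 * ε + 2 * ε * ν.real Set.univ := (norm_sub_le _ _).trans (add_le_add b2 b3)
      _ = _ := by ring
  apply le_of_forall_pos_le_add
  intro δ hδ
  have hpos : 0 < 1 + ν.real Set.univ := by positivity
  have := hstep (δ / (2 * (1 + ν.real Set.univ))) (by positivity)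
  rw [zero_add]
  calc _ ≤ _ := this
    _ = δ := by field_simp

end Integral

/-- Finite measures absolutely continuous with respect to `μ` are determined by the integrals of
the functions `e a`. -/
def IsDetermining {X : Type*} [MeasurableSpace X] {μ : Measure X} {L : Type*}
    (e : L → LInfty μ) : Prop :=
  ∀ ν : Measure X, IsFiniteMeasure ν → ν ≪ μ → (∀ a, ∫ x, e a x ∂ν = ∫ x, e a x ∂μ) → ν = μ

/-- Trace preservation need only be checked on characters: the pullback measure then has the same
Fourier coefficients as μ. -/
theorem IsDetermining.integral_apply_eq {X : Type*} [MeasurableSpace X] {μ : Measure X}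
    [IsProbabilityMeasure μ] {L : Type*} {e : L → LInfty μ} (he : IsDetermining e)
    (α : LInfty μ ≃⋆ₐ[ℂ] LInfty μ)
    (h : ∀ a, ∫ x, (α (e a) : LInfty μ) x ∂μ = ∫ x, e a x ∂μ) (f : LInfty μ) :
    ∫ x, (α f : LInfty μ) x ∂μ = ∫ x, f x ∂μ := by
  rw [integral_apply, he (pullbackMeasure α) inferInstance
    (pullbackMeasure_absolutelyContinuous α) fun a => by rw [← integral_apply, h]]

/-! ### Isomorphism of non-atomic standard probability spaces. -/

section Quantile

open ProbabilityTheory Filter Topology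

variable (μ : Measure ℝ) [IsProbabilityMeasure μ] [NullSingletonClass μ]

/-- The jump of the distribution function at x is the mass of {x}. -/
theorem continuous_cdf : Continuous (cdf μ) := by
  rw [continuous_iff_continuousAt]
  intro x
  rw [(cdf μ).mono.continuousAt_iff_leftLim_eq_rightLim]
  have h := (cdf μ).measure_singleton x
  rw [measure_cdf, NullSingletonClass.measure_singleton, eq_comm, ENNReal.ofReal_eq_zero] at h
  rw [(cdf μ).rightLim_eq]
  exact le_antisymm ((cdf μ).mono.leftLim_le le_rfl) (by linarith)

/-- The quantile function of `μ`, on the open unit interval. -/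
def quantile (t : ℝ) : ℝ :=
  open Classical in if t ∈ Set.Ioo (0 : ℝ) 1 then sInf {x | t ≤ cdf μ x} else 0

variable {μ}

/-- The first part is the Galois connection between quantile and distribution function. The equality
in the second needs continuity, that is, the absence of atoms. -/
theorem quantile_spec {t : ℝ} (ht : t ∈ Set.Ioo (0 : ℝ) 1) :
    (∀ x, quantile μ t ≤ x ↔ t ≤ cdf μ x) ∧ cdf μ (quantile μ t) = t := by
  have hq : quantile μ t = sInf {x | t ≤ cdf μ x} := by rw [quantile, if_pos ht]
  have hne : {x | t ≤ cdf μ x}.Nonempty :=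
    ((tendsto_cdf_atTop μ).eventually_const_le ht.2).exists
  obtain ⟨y, hy⟩ := ((tendsto_cdf_atBot μ).eventually_lt_const ht.1).exists
  have hbdd : BddBelow {x | t ≤ cdf μ x} := ⟨y, fun x hx => by
    by_contra hlt
    exact absurd ((cdf μ).mono (not_le.1 hlt).le) (not_le.2 (hy.trans_le hx))⟩
  have hcl : IsClosed {x | t ≤ cdf μ x} := isClosed_le continuous_const (continuous_cdf μ)
  have hmem : t ≤ cdf μ (quantile μ t) := by
    rw [hq]; exact hcl.csInf_mem hne hbdd
  refine ⟨fun x => ⟨fun h => hmem.trans ((cdf μ).mono h), fun h => ?_⟩, le_antisymm ?_ hmem⟩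
  · rw [hq]; exact csInf_le hbdd h
  · by_contra hlt
    have hev : ∀ᶠ x in 𝓝[<] (quantile μ t), t < cdf μ x :=
      ((continuous_cdf μ).tendsto _).mono_left nhdsWithin_le_nhds |>.eventually_const_lt
        (not_le.1 hlt)
    obtain ⟨x, hx1, hx2⟩ := (hev.and self_mem_nhdsWithin).exists
    have : quantile μ t ≤ x := by rw [hq]; exact csInf_le hbdd hx1.le
    exact absurd hx2 (not_lt.2 this)

theorem measurable_quantile : Measurable (quantile μ) := by
  apply measurable_of_Iic
  intro x
  have : quantile μ ⁻¹' Set.Iic x =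
      -- The second set accounts for the default value 0 outside the open unit interval.
      (Set.Ioo 0 1 ∩ Set.Iic (cdf μ x)) ∪ ((Set.Ioo 0 1)ᶜ ∩ {_t : ℝ | (0 : ℝ) ≤ x}) := by
    ext t
    by_cases ht : t ∈ Set.Ioo (0 : ℝ) 1
    · have h1 := (quantile_spec (μ := μ) ht).1 x
      simp only [Set.mem_preimage, Set.mem_Iic, Set.mem_union, Set.mem_inter_iff, ht,
        Set.mem_compl_iff, h1, true_and, not_true, false_and, or_false]
    · have h1 : quantile μ t = 0 := by rw [quantile, if_neg ht]
      simp only [Set.mem_preimage, Set.mem_Iic, Set.mem_union, Set.mem_inter_iff, ht,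
        Set.mem_compl_iff, h1, Set.mem_ofPred_eq, not_false_iff, true_and, false_and, false_or]
  rw [this]
  exact (measurableSet_Ioo.inter measurableSet_Iic).union
    (measurableSet_Ioo.compl.inter (MeasurableSet.const _))

theorem measurePreserving_quantile :
    MeasurePreserving (quantile μ) (volume.restrict (Set.Ioo (0 : ℝ) 1)) μ := by
  refine ⟨measurable_quantile, ?_⟩
  symm
  apply Measure.ext_of_Iic
  intro x
  rw [Measure.map_apply measurable_quantile measurableSet_Iic,
    Measure.restrict_apply (measurable_quantile measurableSet_Iic)]
  have h1 : quantile μ ⁻¹' Set.Iic x ∩ Set.Ioo 0 1 = Set.Ioo 0 1 ∩ Set.Iic (cdf μ x) := by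
    ext t
    constructor
    · rintro ⟨a, b⟩; exact ⟨b, ((quantile_spec b).1 x).1 a⟩
    · rintro ⟨a, b⟩; exact ⟨((quantile_spec a).1 x).2 b, a⟩
  have h2 : (Set.Ioo 0 1 ∩ Set.Iic (cdf μ x) : Set ℝ) =ᵐ[volume]
      (Set.Ioc 0 1 ∩ Set.Iic (cdf μ x) : Set ℝ) := Ioo_ae_eq_Ioc.inter (ae_eq_refl _)
  rw [h1, measure_congr h2, Set.Ioc_inter_Iic, min_eq_right (cdf_le_one μ x), Real.volume_Ioc,
    sub_zero, ofReal_cdf]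

/-- The distribution function may be constant on intervals, so it is inverted only almost
everywhere: q(F(q(t))) = q(t) on the unit interval is pushed forward along the quantile function q.
-/
theorem quantile_inverse :
    MeasurePreserving (cdf μ) μ (volume.restrict (Set.Ioo (0 : ℝ) 1)) ∧
      (∀ᵐ x ∂μ, quantile μ (cdf μ x) = x) ∧
      ∀ᵐ t ∂(volume.restrict (Set.Ioo (0 : ℝ) 1)), cdf μ (quantile μ t) = t := by
  have hq := measurePreserving_quantile (μ := μ)
  have hF : Measurable (cdf μ) := (continuous_cdf μ).measurable
  have h1 : ∀ᵐ t ∂(volume.restrict (Set.Ioo (0 : ℝ) 1)), cdf μ (quantile μ t) = t := by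
    filter_upwards [ae_restrict_mem measurableSet_Ioo] with t ht
    exact (quantile_spec ht).2
  refine ⟨⟨hF, ?_⟩, ?_, h1⟩
  · have hm : μ.map (cdf μ) = (volume.restrict (Set.Ioo (0 : ℝ) 1)).map (cdf μ ∘ quantile μ) := by
      rw [← Measure.map_map hF hq.measurable, hq.map_eq]
    rw [hm]
    conv_rhs => rw [← Measure.map_id (μ := volume.restrict (Set.Ioo (0 : ℝ) 1))]
    exact Measure.map_congr h1
  · have hm := ae_map_iff (μ := volume.restrict (Set.Ioo (0 : ℝ) 1)) hq.measurable.aemeasurable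
      (measurableSet_eq_fun (hq.measurable.comp hF) measurable_id)
    rw [hq.map_eq] at hm
    refine hm.2 ?_
    filter_upwards [h1] with t ht
    exact congrArg (quantile μ) ht

end Quantile

/-- A non-atomic standard probability space is isomorphic modulo null sets to the unit interval. -/
theorem exists_iso_unitInterval (X : Type*) [MeasurableSpace X] [StandardBorelSpace X]
    (μ : Measure X) [IsProbabilityMeasure μ] [NullSingletonClass μ] :
    ∃ (a : X → ℝ) (b : ℝ → X), MeasurePreserving a μ (volume.restrict (Set.Ioo (0 : ℝ) 1)) ∧
      MeasurePreserving b (volume.restrict (Set.Ioo (0 : ℝ) 1)) μ ∧ (∀ᵐ x ∂μ, b (a x) = x) ∧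
      ∀ᵐ t ∂(volume.restrict (Set.Ioo (0 : ℝ) 1)), a (b t) = t := by
  have hX : ¬ Countable X := by
    intro h
    have h0 : μ Set.univ = 0 := (Set.countable_univ).measure_zero μ
    rw [measure_univ] at h0
    exact one_ne_zero h0
  let φ : X ≃ᵐ ℝ := PolishSpace.measurableEquivOfNotCountable hX (not_countable_iff.2 inferInstance)
  have hφ : MeasurePreserving φ μ (μ.map φ) := φ.measurable.measurePreserving μ
  have hφs : MeasurePreserving φ.symm (μ.map φ) μ := hφ.symm φ
  have : IsProbabilityMeasure (μ.map φ) :=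
    Measure.isProbabilityMeasure_map φ.measurable.aemeasurable
  have : NullSingletonClass (μ.map φ) := ⟨fun x => by
    rw [φ.map_apply]
    have : φ ⁻¹' {x} = {φ.symm x} := by
      ext y
      simp only [Set.mem_preimage, Set.mem_singleton_iff]
      constructor
      · rintro rfl; simp
      · rintro rfl; simp
    rw [this, measure_singleton]⟩
  obtain ⟨h1, h2, h3⟩ := quantile_inverse (μ := μ.map φ)
  refine ⟨_, _, h1.comp hφ, hφs.comp measurePreserving_quantile, ?_, ?_⟩
  · filter_upwards [hφ.quasiMeasurePreserving.ae h2] with x hx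
    simp only [Function.comp, hx, φ.symm_apply_apply]
  · filter_upwards [h3] with t ht
    simp only [Function.comp, φ.apply_symm_apply, ht]

/-- Non-atomic standard probability spaces are isomorphic modulo null sets. -/
theorem exists_iso_of_nonatomic (X Y : Type*) [MeasurableSpace X] [StandardBorelSpace X]
    [MeasurableSpace Y] [StandardBorelSpace Y] (μ : Measure X) [IsProbabilityMeasure μ]
    [NullSingletonClass μ] (ν : Measure Y) [IsProbabilityMeasure ν] [NullSingletonClass ν] :
    ∃ (a : X → Y) (b : Y → X), MeasurePreserving a μ ν ∧ MeasurePreserving b ν μ ∧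
      (∀ᵐ x ∂μ, b (a x) = x) ∧ ∀ᵐ y ∂ν, a (b y) = y := by
  obtain ⟨a, b, ha, hb, h1, h2⟩ := exists_iso_unitInterval X μ
  obtain ⟨c, d, hc, hd, h3, h4⟩ := exists_iso_unitInterval Y ν
  refine ⟨d ∘ a, b ∘ c, hd.comp ha, hb.comp hc, ?_, ?_⟩
  · filter_upwards [h1, ha.quasiMeasurePreserving.ae h4] with x hx hx'
    simp only [Function.comp, hx', hx]
  · filter_upwards [h3, hc.quasiMeasurePreserving.ae h2] with x hx hx'
    simp only [Function.comp, hx', hx]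

/-! ### Null sets from square summability. -/

namespace IsFourierSystem

variable {X : Type*} [MeasurableSpace X] {μ : Measure X} [IsProbabilityMeasure μ]
  {L : Type*} [AddCommGroup L] {e : L → LInfty μ} (he : IsFourierSystem e)
include he

/-- Only finitely many Fourier coefficients are larger than a given positive number. -/
theorem finite_le_norm_coeff (f : Lp ℂ 2 μ) {c : ℝ} (hc : 0 < c) :
    {a | c ≤ ‖inner ℂ (toL2 (e a)) f‖}.Finite := by
  have h1 := (he.orthonormal.inner_products_summable f).tendsto_cofinite_zero
  have h2 := h1.eventually_lt_const (show (0 : ℝ) < c ^ 2 by positivity)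
  rw [Filter.eventually_cofinite] at h2
  refine h2.subset fun a ha => ?_
  rw [Set.mem_ofPred_eq] at ha ⊢
  rw [not_lt]
  exact pow_le_pow_left₀ hc.le ha 2

/-- A measurable set on which infinitely many characters are constant is a null set. -/
theorem measure_eq_zero_of_infinite {A : Set X} (hA : MeasurableSet A) {S : Set L}
    (hS : S.Infinite) (h : ∀ a ∈ S, ∃ c : ℂ, ‖c‖ = 1 ∧ ∀ᵐ x ∂μ, x ∈ A → e a x = c) : μ A = 0 := by
  by_contra hne
  have hpos : 0 < μ.real A := ENNReal.toReal_pos hne (measure_ne_top _ _)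
  refine hS ((he.finite_le_norm_coeff (toL2 (indL μ hA)) hpos).subset fun a ha => ?_)
  obtain ⟨c, hc, hac⟩ := h a ha
  -- For every a in S the coefficient of the indicator of A has modulus μ(A), and only finitely many
  -- coefficients can be that large.
  have h1 : inner ℂ (toL2 (e a)) (toL2 (indL μ hA)) = μ.real A • star c := by
    rw [inner_toL2, ← integral_indicator_const (star c) hA]
    apply integral_congr_ae
    filter_upwards [coeFn_mul (star (e a)) (indL μ hA), coeFn_star' (e a),
      coeFn_indL (μ := μ) hA, hac] with x h1 h2 h3 h4
    rw [h1, h2, h3]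
    by_cases hx : x ∈ A
    · simp [hx, h4 hx]
    · simp [hx]
  rw [Set.mem_ofPred_eq, h1, norm_smul, norm_star, hc, mul_one, Real.norm_of_nonneg hpos.le]

end IsFourierSystem

/-! ### The compact dual of a discrete abelian group. -/

section Dual

variable (L : Type*) [AddCommGroup L]

/-- The compact group of characters of the discrete group `L`. -/
def charGroup : Subgroup (L → Circle) where
  carrier := {χ | ∀ a b, χ (a + b) = χ a * χ b}
  one_mem' := fun a b => by simp
  mul_mem' := fun {x y} hx hy a b => by
    rw [Pi.mul_apply, Pi.mul_apply, Pi.mul_apply, hx a b, hy a b, mul_mul_mul_comm]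
  inv_mem' := fun {x} hx a b => by
    rw [Pi.inv_apply, Pi.inv_apply, Pi.inv_apply, hx a b, mul_inv]

theorem isClosed_charGroup : IsClosed (charGroup L : Set (L → Circle)) := by
  have : (charGroup L : Set (L → Circle)) = ⋂ a, ⋂ b, {χ | χ (a + b) = χ a * χ b} := by
    ext χ
    simp only [Set.mem_iInter]
    rfl
  rw [this]
  exact isClosed_iInter fun a => isClosed_iInter fun b =>
    isClosed_eq (continuous_apply _) (by fun_prop)

instance : CompactSpace (charGroup L) :=
  isCompact_iff_compactSpace.1 (isClosed_charGroup L).isCompact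

instance [Countable L] : PolishSpace (charGroup L) :=
  have : PolishSpace (L → Circle) := by
    have : SecondCountableTopology (L → Circle) := inferInstance
    have : TopologicalSpace.IsCompletelyMetrizableSpace (L → Circle) := inferInstance
    exact inferInstance
  (isClosed_charGroup L).polishSpace

instance : MeasurableSpace (charGroup L) := borel _

instance : BorelSpace (charGroup L) := ⟨rfl⟩

/-- The normalized Haar measure. -/
def charHaar : Measure (charGroup L) := Measure.haarMeasure ⊤

instance : IsProbabilityMeasure (charHaar L) := ⟨Measure.haarMeasure_self (K₀ := ⊤)⟩

instance : (charHaar L).IsMulLeftInvariant := inferInstanceAs (Measure.haarMeasure _).IsMulLeftInvariant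

variable {L}

theorem charGroup_map_zero (χ : charGroup L) : χ.1 0 = 1 := by
  have h := χ.2 0 0
  rw [add_zero] at h
  exact left_eq_mul.1 h

theorem charGroup_map_neg (χ : charGroup L) (a : L) : χ.1 (-a) = (χ.1 a)⁻¹ := by
  have h := χ.2 (-a) a
  rw [neg_add_cancel, charGroup_map_zero] at h
  exact eq_inv_of_mul_eq_one_left h.symm

/-- Characters separate the points of a discrete abelian group. -/
theorem exists_charGroup_ne_one {a : L} (ha : a ≠ 0) : ∃ χ : charGroup L, χ.1 a ≠ 1 := by
  obtain ⟨c, hc⟩ := CharacterModule.exists_character_apply_ne_zero_of_ne_zero ha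
  -- The separating character c takes values in ℚ/ℤ; the injection into ℝ/ℤ makes it circle-valued.
  let φ : AddCircle (1 : ℚ) →+ AddCircle (1 : ℝ) :=
    QuotientAddGroup.map _ _ (Rat.castHom ℝ).toAddMonoidHom (by
      rw [AddSubgroup.zmultiples_le]
      exact AddSubgroup.mem_zmultiples_iff.2 ⟨1, by simp⟩)
  have hφ : ∀ x, φ x = 0 → x = 0 := by
    intro x
    induction x using QuotientAddGroup.induction_on with
    | H q =>
      intro h
      have h1 : ((q : ℝ) : AddCircle (1 : ℝ)) = 0 := h
      obtain ⟨n, hn⟩ := AddSubgroup.mem_zmultiples_iff.1 ((QuotientAddGroup.eq_zero_iff _).1 h1)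
      refine (QuotientAddGroup.eq_zero_iff _).2 (AddSubgroup.mem_zmultiples_iff.2 ⟨n, ?_⟩)
      rw [zsmul_eq_mul, mul_one] at hn ⊢
      exact_mod_cast hn
  refine ⟨⟨fun b => AddCircle.toCircle (φ (c b)), fun a b => ?_⟩, fun h => hc (hφ _ ?_)⟩
  · change AddCircle.toCircle (φ (c (a + b))) = _
    rw [map_add, map_add, AddCircle.toCircle_add]
  · apply AddCircle.injective_toCircle (one_ne_zero : (1 : ℝ) ≠ 0)
    rw [AddCircle.toCircle_zero]
    exact h

/-- Evaluation at `a`, as a continuous function on the group of characters. -/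
def evalChar (a : L) : C(charGroup L, ℂ) :=
  ⟨fun χ => (χ.1 a : ℂ), by
    have h : Continuous fun χ : charGroup L => χ.1 a :=
      (continuous_apply a).comp continuous_subtype_val
    exact continuous_induced_dom.comp h⟩

theorem evalChar_apply (a : L) (χ : charGroup L) : evalChar a χ = (χ.1 a : ℂ) := rfl

theorem norm_evalChar (a : L) (χ : charGroup L) : ‖evalChar a χ‖ = 1 := Circle.norm_coe _

theorem evalChar_add (a b : L) (χ : charGroup L) :
    evalChar (a + b) χ = evalChar a χ * evalChar b χ := by
  simp only [evalChar_apply, χ.2 a b, Circle.coe_mul]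

theorem evalChar_neg (a : L) (χ : charGroup L) : evalChar (-a) χ = star (evalChar a χ) := by
  simp only [evalChar_apply, charGroup_map_neg, Circle.coe_inv_eq_conj, Complex.star_def]

theorem evalChar_zero (χ : charGroup L) : evalChar (0 : L) χ = 1 := by
  rw [evalChar_apply, charGroup_map_zero, Circle.coe_one]

/-- Translation by a point χ₀ with χ₀(a) ≠ 1 multiplies the integral by χ₀(a), yet Haar measure is
invariant. -/
theorem integral_evalChar {a : L} (ha : a ≠ 0) : ∫ χ, evalChar a χ ∂(charHaar L) = 0 := by
  obtain ⟨χ₀, h⟩ := exists_charGroup_ne_one ha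
  have h1 := integral_mul_left_eq_self (μ := charHaar L) (fun χ => evalChar a χ) χ₀
  have h2 : ∀ χ, evalChar a (χ₀ * χ) = (χ₀.1 a : ℂ) * evalChar a χ := fun χ => by
    simp only [evalChar_apply, Subgroup.coe_mul, Pi.mul_apply, Circle.coe_mul]
  simp_rw [h2] at h1
  rw [integral_const_mul] at h1
  by_contra hne
  exact h (Circle.ext (by rw [Circle.coe_one]; exact (mul_eq_right₀ hne).1 h1))

variable (L) in
/-- The star algebra of trigonometric polynomials. -/
def trigSubalgebra : StarSubalgebra ℂ C(charGroup L, ℂ) where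
  toSubalgebra := Algebra.adjoin ℂ (Set.range evalChar)
  star_mem' := by
    change Algebra.adjoin ℂ (Set.range evalChar) ≤ star (Algebra.adjoin ℂ (Set.range evalChar))
    refine Algebra.adjoin_le ?_
    rintro - ⟨a, rfl⟩
    exact Algebra.subset_adjoin ⟨-a, ContinuousMap.ext fun χ => evalChar_neg a χ⟩

/-- Stone–Weierstrass. Evaluations are closed under products, so the algebra they generate is
already their linear span. -/
theorem span_evalChar_closure :
    (Submodule.span ℂ (Set.range (evalChar (L := L)))).topologicalClosure = ⊤ := by
  have h1 : Subalgebra.toSubmodule (trigSubalgebra L).toSubalgebra =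
      Submodule.span ℂ (Set.range evalChar) := by
    apply Algebra.adjoin_eq_span_of_subset
    refine Set.Subset.trans ?_ Submodule.subset_span
    intro x hx
    refine Submonoid.closure_induction (fun _ => id)
      ⟨0, ContinuousMap.ext fun χ => evalChar_zero χ⟩ ?_ hx
    rintro - - - - ⟨a, rfl⟩ ⟨b, rfl⟩
    exact ⟨a + b, ContinuousMap.ext fun χ => evalChar_add a b χ⟩
  have h2 : (trigSubalgebra L).topologicalClosure = ⊤ := by
    apply ContinuousMap.starSubalgebra_topologicalClosure_eq_top_of_separatesPoints
    intro x y hxy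
    have hne : x.1 ≠ y.1 := fun h => hxy (Subtype.ext h)
    obtain ⟨a, ha⟩ := Function.ne_iff.1 hne
    refine ⟨_, ⟨evalChar a, Algebra.subset_adjoin ⟨a, rfl⟩, rfl⟩, fun h => ha (Circle.ext h)⟩
  rw [← h1]
  exact congr_arg (Subalgebra.toSubmodule <| StarSubalgebra.toSubalgebra ·) h2

variable [Countable L]

/-- Finite measures on the group of characters are determined by their Fourier coefficients. -/
theorem measure_ext_of_evalChar (ν₁ ν₂ : Measure (charGroup L)) [IsFiniteMeasure ν₁]
    [IsFiniteMeasure ν₂] (h : ∀ a, ∫ χ, evalChar a χ ∂ν₁ = ∫ χ, evalChar a χ ∂ν₂) : ν₁ = ν₂ := by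
  have hint : ∀ (f : C(charGroup L, ℂ)) (ν : Measure (charGroup L)) [IsFiniteMeasure ν],
      Integrable (fun χ => f χ) ν := fun f ν _ =>
    Integrable.of_bound f.continuous.aestronglyMeasurable ‖f‖ (.of_forall fun χ => f.norm_coe_le_norm χ)
  have hspan : ∀ f ∈ Submodule.span ℂ (Set.range (evalChar (L := L))),
      ∫ χ, f χ ∂ν₁ = ∫ χ, f χ ∂ν₂ := by
    intro f hf
    induction hf using Submodule.span_induction with
    | mem f hf => obtain ⟨a, rfl⟩ := hf; exact h a
    | zero => simp
    | add f g _ _ hf hg =>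
      simp only [ContinuousMap.add_apply]
      rw [integral_add (hint f ν₁) (hint g ν₁), integral_add (hint f ν₂) (hint g ν₂), hf, hg]
    | smul c f _ hf =>
      simp only [ContinuousMap.smul_apply]
      rw [integral_smul, integral_smul, hf]
  have hall : ∀ f : C(charGroup L, ℂ), ∫ χ, f χ ∂ν₁ = ∫ χ, f χ ∂ν₂ := by
    intro f
    have hf : f ∈ (Submodule.span ℂ (Set.range (evalChar (L := L)))).topologicalClosure := by
      rw [span_evalChar_closure]; trivial
    rw [← sub_eq_zero, ← norm_le_zero_iff]
    have key : ∀ ε > 0, ‖∫ χ, f χ ∂ν₁ - ∫ χ, f χ ∂ν₂‖ ≤ ε * (ν₁.real Set.univ + ν₂.real Set.univ) := by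
      intro ε hε
      obtain ⟨p, hp, hpε⟩ := Metric.mem_closure_iff.1 hf ε hε
      rw [dist_eq_norm] at hpε
      have b : ∀ (ν : Measure (charGroup L)) [IsFiniteMeasure ν],
          ‖∫ χ, f χ ∂ν - ∫ χ, p χ ∂ν‖ ≤ ε * ν.real Set.univ := by
        intro ν _
        rw [← integral_sub (hint f ν) (hint p ν)]
        exact norm_integral_le_of_norm_le_const
          (.of_forall fun χ => ((f - p).norm_coe_le_norm χ).trans hpε.le)
      calc _ = ‖(∫ χ, f χ ∂ν₁ - ∫ χ, p χ ∂ν₁) - (∫ χ, f χ ∂ν₂ - ∫ χ, p χ ∂ν₂)‖ := by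
            rw [hspan p hp]; congr 1; ring
        _ ≤ ε * ν₁.real Set.univ + ε * ν₂.real Set.univ :=
            (norm_sub_le _ _).trans (add_le_add (b ν₁) (b ν₂))
        _ = _ := by ring
    apply le_of_forall_pos_le_add
    intro δ hδ
    -- The summand 1 keeps the denominator positive even if both measures vanish.
    have hpos : 0 < 1 + (ν₁.real Set.univ + ν₂.real Set.univ) := by positivity
    refine (key (δ / (1 + (ν₁.real Set.univ + ν₂.real Set.univ))) (by positivity)).trans ?_
    rw [zero_add, div_mul_eq_mul_div, div_le_iff₀ hpos]
    nlinarith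
  apply ext_of_forall_integral_eq_of_IsFiniteMeasure
  intro f
  have h1 := hall ⟨fun χ => (f χ : ℂ), Complex.continuous_ofReal.comp f.continuous⟩
  simp only [ContinuousMap.coe_mk, integral_complex_ofReal] at h1
  exact_mod_cast h1

end Dual

/-! ### Transport of the characters from the dual group to X. -/

section Transport

variable {X : Type*} [MeasurableSpace X] {μ : Measure X} [IsProbabilityMeasure μ]
  {L : Type*} [AddCommGroup L] [Countable L] {A : X → charGroup L}

/-- The characters of `L` as functions on `X`, for a measure preserving map from `X` to the group
of characters. -/
def pullChar (hA : MeasurePreserving A μ (charHaar L)) (a : L) : LInfty μ :=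
  mkLInfty (fun x => evalChar a (A x))
    ((evalChar a).continuous.measurable.comp hA.measurable).aestronglyMeasurable 1
    (.of_forall fun _ => (norm_evalChar _ _).le)

omit [IsProbabilityMeasure μ] [Countable L] in
theorem coeFn_pullChar (hA : MeasurePreserving A μ (charHaar L)) (a : L) :
    ⇑(pullChar hA a) =ᵐ[μ] fun x => evalChar a (A x) := coeFn_mkLInfty _ _ _ _

omit [IsProbabilityMeasure μ] [Countable L] in
theorem integral_pullChar (hA : MeasurePreserving A μ (charHaar L)) (a : L) (ν : Measure X)
    (hν : ν ≪ μ) : ∫ x, pullChar hA a x ∂ν = ∫ χ, evalChar a χ ∂(ν.map A) := by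
  rw [integral_map hA.measurable.aemeasurable (evalChar a).continuous.aestronglyMeasurable]
  exact integral_congr_ae (hν.ae_eq (coeFn_pullChar hA a))

theorem isFourierSystem_pullChar (hA : MeasurePreserving A μ (charHaar L)) {B : charGroup L → X}
    (hB : MeasurePreserving B (charHaar L) μ) (hBA : ∀ᵐ x ∂μ, B (A x) = x) :
    IsFourierSystem (pullChar hA) where
  char_add a b := by
    apply Lp.ext
    filter_upwards [coeFn_mul (pullChar hA a) (pullChar hA b), coeFn_pullChar hA a,
      coeFn_pullChar hA b, coeFn_pullChar hA (a + b)] with x h1 h2 h3 h4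
    rw [h1, h2, h3, h4, evalChar_add]
  char_neg a := by
    apply Lp.ext
    filter_upwards [coeFn_star' (pullChar hA a), coeFn_pullChar hA a,
      coeFn_pullChar hA (-a)] with x h1 h2 h3
    rw [h1, h2, h3, evalChar_neg]
  char_zero := by
    apply Lp.ext
    filter_upwards [coeFn_linftyOne (μ := μ), coeFn_pullChar hA 0] with x h1 h2
    rw [h1, h2, evalChar_zero]
  integral_eq_zero a ha := by
    rw [integral_pullChar hA a μ Measure.AbsolutelyContinuous.rfl, hA.map_eq, integral_evalChar ha]
  dense := by
    have h1 : Dense ((Submodule.span ℂ (Set.range fun a : L =>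
        ContinuousMap.toLp 2 (charHaar L) ℂ (evalChar a))) : Set (Lp ℂ 2 (charHaar L))) := by
      have := (ContinuousMap.toLp_denseRange ℂ (charHaar L) (p := 2) ℂ
        (by norm_num)).topologicalClosure_map_submodule span_evalChar_closure
      rw [Submodule.map_span, ← Set.range_comp] at this
      exact Submodule.dense_iff_topologicalClosure_eq_top.2 this
    let I := Lp.compMeasurePreservingₗᵢ (E := ℂ) (p := 2) ℂ A hA
    -- Density in L² of the dual passes to L²(X) only because composition with A is onto;
    -- composition with B supplies preimages.
    have hIs : Function.Surjective I := by
      intro g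
      refine ⟨Lp.compMeasurePreserving B hB g, ?_⟩
      apply Lp.ext
      filter_upwards [Lp.coeFn_compMeasurePreserving (Lp.compMeasurePreserving B hB g) hA,
        hA.quasiMeasurePreserving.ae (Lp.coeFn_compMeasurePreserving g hB), hBA] with x e1 e2 e3
      change Lp.compMeasurePreserving A hA _ x = _
      rw [e1, Function.comp, e2, Function.comp, e3]
    have h2 := hIs.denseRange.dense_image I.continuous h1
    have h3 : I '' ((Submodule.span ℂ (Set.range fun a : L =>
        ContinuousMap.toLp 2 (charHaar L) ℂ (evalChar a))) : Set (Lp ℂ 2 (charHaar L))) =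
        (Submodule.span ℂ (Set.range fun a => toL2 (pullChar hA a)) : Set (Lp ℂ 2 μ)) := by
      have h4 := Submodule.map_span I.toLinearMap
        (Set.range fun a : L => ContinuousMap.toLp 2 (charHaar L) ℂ (evalChar a))
      rw [← Set.range_comp] at h4
      have h5 : (I.toLinearMap ∘ fun a : L => ContinuousMap.toLp 2 (charHaar L) ℂ (evalChar a)) =
          fun a => toL2 (pullChar hA a) := by
        funext a
        apply Lp.ext
        filter_upwards [Lp.coeFn_compMeasurePreserving
          (ContinuousMap.toLp 2 (charHaar L) ℂ (evalChar a)) hA,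
          hA.quasiMeasurePreserving.ae (ContinuousMap.coeFn_toLp (p := 2) (charHaar L) (𝕜 := ℂ)
            (evalChar a)),
          coeFn_toL2 (pullChar hA a), coeFn_pullChar hA a] with x e1 e2 e3 e4
        change Lp.compMeasurePreserving A hA _ x = _
        rw [e1, Function.comp, e2, e3, e4]
      rw [h5] at h4
      exact congrArg (fun S : Submodule ℂ (Lp ℂ 2 μ) => (S : Set (Lp ℂ 2 μ))) h4
    rw [h3] at h2
    exact (Submodule.dense_iff_topologicalClosure_eq_top.1 h2).ge

/-- Every character is constant on a singleton, and there are infinitely many. -/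
theorem nullSingletonClass_charHaar [Infinite L] : NullSingletonClass (charHaar L) := by
  have he := isFourierSystem_pullChar (L := L) (MeasurePreserving.id (charHaar L))
    (MeasurePreserving.id (charHaar L)) (.of_forall fun _ => rfl)
  refine ⟨fun χ => he.measure_eq_zero_of_infinite (measurableSet_singleton χ)
    (Set.infinite_univ) fun a _ => ⟨evalChar a χ, norm_evalChar a χ, ?_⟩⟩
  filter_upwards [coeFn_pullChar (MeasurePreserving.id (charHaar L)) a] with x h1 hx
  rw [h1, Set.mem_singleton_iff.1 hx]
  rfl

/-- Composition with an automorphism of `L` preserves Haar measure. -/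
theorem exists_measurePreserving_charGroup (σ : L ≃+ L) :
    ∃ S : charGroup L → charGroup L, MeasurePreserving S (charHaar L) (charHaar L) ∧
      ∀ a χ, evalChar a (S χ) = evalChar (σ a) χ := by
  let S : charGroup L → charGroup L := fun χ =>
    ⟨fun a => χ.1 (σ a), fun a b => by
      change χ.1 (σ (a + b)) = _
      rw [map_add]
      exact χ.2 _ _⟩
  have hS : Continuous S := by
    apply Continuous.subtype_mk
    exact continuous_pi fun a => (continuous_apply (σ a)).comp continuous_subtype_val
  refine ⟨S, ⟨hS.measurable, ?_⟩, fun a χ => rfl⟩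
  have : IsProbabilityMeasure ((charHaar L).map S) :=
    Measure.isProbabilityMeasure_map hS.measurable.aemeasurable
  apply measure_ext_of_evalChar
  intro a
  rw [integral_map hS.measurable.aemeasurable (evalChar a).continuous.aestronglyMeasurable]
  change ∫ χ, evalChar (σ a) χ ∂(charHaar L) = _
  by_cases ha : a = 0
  · rw [ha, map_zero]
  · rw [integral_evalChar ha, integral_evalChar (by simpa using ha)]

end Transport

/-- On a non-atomic standard probability space there is a system of characters for every countably
infinite abelian group, and group automorphisms are realized by point transformations. -/
theorem exists_isFourierSystem (L : Type*) [AddCommGroup L] [Countable L] [Infinite L]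
    (X : Type*) [MeasurableSpace X] [StandardBorelSpace X] (μ : Measure X)
    [IsProbabilityMeasure μ] [NullSingletonClass μ] :
    ∃ e : L → LInfty μ, IsFourierSystem e ∧ IsDetermining e ∧
      ∀ σ : L ≃+ L, ∃ T : X → X, MeasurePreserving T μ μ ∧
        ∀ a, ⇑(e (σ a)) =ᵐ[μ] ⇑(e a) ∘ T := by
  have := nullSingletonClass_charHaar (L := L)
  obtain ⟨A, B, hA, hB, hBA, hAB⟩ := exists_iso_of_nonatomic X (charGroup L) μ (charHaar L)
  refine ⟨pullChar hA, isFourierSystem_pullChar hA hB hBA, ?_, ?_⟩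
  · intro ν _ hν h
    have h1 : ν.map A = charHaar L := by
      apply measure_ext_of_evalChar
      intro a
      rw [← integral_pullChar hA a ν hν, h,
        integral_pullChar hA a μ Measure.AbsolutelyContinuous.rfl, hA.map_eq]
    have h2 : (ν.map A).map B = ν := by
      rw [Measure.map_map hB.measurable hA.measurable]
      conv_rhs => rw [← Measure.map_id (μ := ν)]
      exact Measure.map_congr (hν.ae_le hBA)
    rw [← h2, h1, hB.map_eq]
  · intro σ
    obtain ⟨S, hS, hSe⟩ := exists_measurePreserving_charGroup σ
    have hT : MeasurePreserving (B ∘ S ∘ A) μ μ := hB.comp (hS.comp hA)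
    refine ⟨_, hT, fun a => ?_⟩
    filter_upwards [coeFn_pullChar hA (σ a), hT.quasiMeasurePreserving.ae (coeFn_pullChar hA a),
      (hS.comp hA).quasiMeasurePreserving.ae hAB] with x h1 h2 h3
    rw [h1, Function.comp, h2]
    simp only [Function.comp] at h3 ⊢
    rw [h3, hSe]

/-! ### Affine maps of ℤ² and generators of Λ(H). -/

section AffineGroup

theorem affine_smul_def (g : AffineSL) (m : Fin 2 → ℤ) :
    g • m = g.left.toAdd + g.right.1.mulVec m := rfl

/-- The element `m ↦ k + A m` of `ℤ² ⋊ SL(2, ℤ)`, with `A` given by its entries. -/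
def affine (k : Fin 2 → ℤ) (a b c d : ℤ) (h : a * d - b * c = 1) : AffineSL :=
  ⟨Multiplicative.ofAdd k, ⟨!![a, b; c, d], by rw [Matrix.det_fin_two_of, h]⟩⟩

theorem affine_smul (k : Fin 2 → ℤ) (a b c d : ℤ) (h : a * d - b * c = 1) (m : Fin 2 → ℤ) :
    affine k a b c d h • m = ![k 0 + (a * m 0 + b * m 1), k 1 + (c * m 0 + d * m 1)] := by
  rw [affine_smul_def]
  funext i
  fin_cases i <;> simp [affine, dotProduct, Fin.sum_univ_two]

/-- Translation by `k`. -/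
def translation (k : Fin 2 → ℤ) : AffineSL := affine k 1 0 0 1 (by norm_num)

theorem translation_smul (k m : Fin 2 → ℤ) : translation k • m = k + m := by
  rw [translation, affine_smul]
  funext i
  fin_cases i <;> simp

end AffineGroup

section LamGenerators

variable {H : Type*} [AddCommGroup H]

/-- The function with value `h` at `m` and `-h` at `n`. -/
def dif (m n : Fin 2 → ℤ) (h : H) : Lam H :=
  ⟨Finsupp.single m h - Finsupp.single n h, by
    change (Finsupp.liftAddHom fun _ : Fin 2 → ℤ => AddMonoidHom.id H) _ = 0
    rw [map_sub]
    simp⟩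

open Classical in
theorem dif_apply (m n : Fin 2 → ℤ) (h : H) (p : Fin 2 → ℤ) :
    (dif m n h).1 p = (if m = p then h else 0) - (if n = p then h else 0) := by
  change (Finsupp.single m h - Finsupp.single n h) p = _
  rw [Finsupp.sub_apply, Finsupp.single_apply, Finsupp.single_apply]

theorem lam_ext {a b : Lam H} (h : ∀ m, a.1 m = b.1 m) : a = b :=
  Subtype.ext (Finsupp.ext h)

theorem lam_add_apply (a b : Lam H) (m : Fin 2 → ℤ) : (a + b).1 m = a.1 m + b.1 m := rfl

theorem lam_sub_apply (a b : Lam H) (m : Fin 2 → ℤ) : (a - b).1 m = a.1 m - b.1 m := rfl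

theorem lamAct_dif (g : AffineSL) (m n : Fin 2 → ℤ) (h : H) :
    lamAct H g (dif m n h) = dif (g • m) (g • n) h := by
  apply lam_ext
  intro p
  classical
  rw [lamAct_apply, dif_apply, dif_apply]
  simp only [eq_inv_smul_iff]

theorem dif_add_dif (m n p : Fin 2 → ℤ) (h : H) : dif m n h + dif n p h = dif m p h :=
  Subtype.ext (sub_add_sub_cancel _ _ _)

theorem neg_dif (m n : Fin 2 → ℤ) (h : H) : -dif m n h = dif n m h :=
  Subtype.ext (neg_sub _ _)

theorem dif_self (m : Fin 2 → ℤ) (h : H) : dif m m h = 0 := Subtype.ext (sub_self _)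

theorem dif_add (m n : Fin 2 → ℤ) (h h' : H) : dif m n (h + h') = dif m n h + dif m n h' := by
  apply lam_ext
  intro p
  classical
  rw [lam_add_apply, dif_apply, dif_apply, dif_apply]
  split_ifs <;> abel

theorem dif_injective {m n : Fin 2 → ℤ} (hmn : m ≠ n) :
    Function.Injective (dif m n : H → Lam H) := by
  intro h h' heq
  classical
  have := congrArg (fun a : Lam H => a.1 m) heq
  simp only [dif_apply, if_pos, if_neg hmn.symm, sub_zero] at this
  exact this

theorem lamAct_inv_apply_self (g : AffineSL) (a : Lam H) : lamAct H g⁻¹ (lamAct H g a) = a := by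
  rw [← Equiv.Perm.mul_apply, ← map_mul, inv_mul_cancel, map_one, Equiv.Perm.one_apply]

theorem lamAct_apply_inv_self (g : AffineSL) (a : Lam H) : lamAct H g (lamAct H g⁻¹ a) = a := by
  rw [← Equiv.Perm.mul_apply, ← map_mul, mul_inv_cancel, map_one, Equiv.Perm.one_apply]

theorem lamAct_smul_apply (g : AffineSL) (a : Lam H) (m : Fin 2 → ℤ) :
    (lamAct H g a).1 (g • m) = a.1 m := by
  rw [lamAct_apply, inv_smul_smul]

/-- An element of `Λ(H)` supported at one point vanishes. -/
theorem lam_eq_zero_of_support {a : Lam H} {m : Fin 2 → ℤ} (h : ∀ p, p ≠ m → a.1 p = 0) :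
    a = 0 := by
  have h1 := mem_lam.1 a.2
  have h2 : a.1 = Finsupp.single m (a.1 m) := by
    ext p
    by_cases hp : p = m
    · rw [hp, Finsupp.single_eq_same]
    · rw [h p hp, Finsupp.single_eq_of_ne hp]
  rw [h2, Finsupp.sum_single_index rfl] at h1
  apply Subtype.ext
  rw [h2, h1, Finsupp.single_zero]
  rfl

/-- An element of `Λ(H)` supported at two points. -/
theorem lam_eq_dif_of_support {a : Lam H} {m n : Fin 2 → ℤ}
    (h : ∀ p, p ≠ m → p ≠ n → a.1 p = 0) : a = dif m n (-a.1 n) := by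
  classical
  rw [← sub_eq_zero]
  apply lam_eq_zero_of_support (m := m)
  intro p hp
  rw [lam_sub_apply, dif_apply, if_neg hp.symm]
  split_ifs with hn
  · rw [hn]; abel
  · rw [h p hp (Ne.symm hn)]; abel

/-- `Λ(H)` is generated, as a group with an action of `ℤ² ⋊ SL(2, ℤ)`, by the functions
supported at `0` and `(1, 0)`. -/
theorem lam_induction (S : AddSubgroup (Lam H)) (h0 : ∀ h, dif 0 ![1, 0] h ∈ S)
    (hS : ∀ g, ∀ a ∈ S, lamAct H g a ∈ S) (a : Lam H) : a ∈ S := by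
  have htr : ∀ v k : Fin 2 → ℤ, (∀ h, dif 0 v h ∈ S) → ∀ h, dif k (k + v) h ∈ S := by
    intro v k hv h
    have := hS (translation k) _ (hv h)
    rwa [lamAct_dif, translation_smul, translation_smul, add_zero] at this
  let R : AddSubgroup (Fin 2 → ℤ) :=
    { carrier := {v | ∀ h, dif 0 v h ∈ S}
      zero_mem' := fun h => by rw [dif_self]; exact S.zero_mem
      add_mem' := fun {v w} hv hw h => by
        rw [← dif_add_dif 0 v]
        exact S.add_mem (hv h) (htr w v hw h)
      neg_mem' := fun {v} hv h => by
        have := htr v (-v) hv h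
        rw [neg_add_cancel] at this
        rw [← neg_dif]
        exact S.neg_mem this }
  have hR : ∀ v, v ∈ R := by
    intro v
    have h1 : (![1, 0] : Fin 2 → ℤ) ∈ R := h0
    have h2 : (![0, 1] : Fin 2 → ℤ) ∈ R := by
      intro h
      -- The quarter turn carries (1,0) to (0,1) and fixes 0.
      have := hS (affine 0 0 (-1) 1 0 (by norm_num)) _ (h0 h)
      rw [lamAct_dif, affine_smul, affine_smul] at this
      convert! this using 2
      funext i
      fin_cases i <;> simp
    have h3 : v = v 0 • ![1, 0] + v 1 • ![0, 1] := by
      funext i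
      fin_cases i <;> simp
    rw [h3]
    exact R.add_mem (R.zsmul_mem h1 _) (R.zsmul_mem h2 _)
  -- The contributions at 0 add up to the sum of the values of a, which is zero.
  have h4 : a = -∑ m ∈ a.1.support, dif 0 m (a.1 m) := by
    apply Subtype.ext
    rw [AddSubgroup.coe_neg, AddSubgroup.val_finsetSum]
    change a.1 = -∑ m ∈ a.1.support, (Finsupp.single 0 (a.1 m) - Finsupp.single m (a.1 m))
    rw [Finset.sum_sub_distrib, neg_sub]
    have h5 : ∑ m ∈ a.1.support, Finsupp.single (0 : Fin 2 → ℤ) (a.1 m) = 0 := by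
      rw [← Finsupp.single_finsetSum]
      have := mem_lam.1 a.2
      rw [Finsupp.sum] at this
      rw [this, Finsupp.single_zero]
    rw [h5, sub_zero]
    exact (Finsupp.sum_single a.1).symm
  rw [h4]
  exact S.neg_mem (S.sum_mem fun m _ => hR m _)

/-- The endomorphism of `Λ(H)` induced by an endomorphism of `H`. -/
def mapLam (φ : H →+ H) : Lam H →+ Lam H where
  toFun a := ⟨Finsupp.mapRange φ (map_zero φ) a.1, by
    rw [mem_lam, Finsupp.sum_mapRange_index (fun _ => rfl)]
    have := mem_lam.1 a.2
    rw [Finsupp.sum] at this ⊢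
    rw [← map_sum, this, map_zero]⟩
  map_zero' := lam_ext fun _ => map_zero φ
  map_add' a b := lam_ext fun m => map_add φ (a.1 m) (b.1 m)

theorem mapLam_apply (φ : H →+ H) (a : Lam H) (m : Fin 2 → ℤ) :
    (mapLam φ a).1 m = φ (a.1 m) := rfl

theorem mapLam_dif (φ : H →+ H) (m n : Fin 2 → ℤ) (h : H) :
    mapLam φ (dif m n h) = dif m n (φ h) := by
  classical
  apply lam_ext
  intro p
  rw [mapLam_apply, dif_apply, dif_apply, map_sub]
  split_ifs <;> simp

theorem mapLam_lamAct (φ : H →+ H) (g : AffineSL) (a : Lam H) :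
    mapLam φ (lamAct H g a) = lamAct H g (mapLam φ a) :=
  lam_ext fun _ => rfl

/-- The automorphism of `Λ(H)` induced by an automorphism of `H`. -/
def mapLamEquiv (φ : H ≃+ H) : Lam H ≃+ Lam H :=
  { mapLam φ.toAddMonoidHom with
    invFun := mapLam φ.symm.toAddMonoidHom
    left_inv := fun a => lam_ext fun m => φ.symm_apply_apply (a.1 m)
    right_inv := fun a => lam_ext fun m => φ.apply_symm_apply (a.1 m) }

theorem mapLamEquiv_apply (φ : H ≃+ H) (a : Lam H) (m : Fin 2 → ℤ) :
    (mapLamEquiv φ a).1 m = φ (a.1 m) := rfl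

theorem mapLamEquiv_dif (φ : H ≃+ H) (m n : Fin 2 → ℤ) (h : H) :
    mapLamEquiv φ (dif m n h) = dif m n (φ h) := mapLam_dif φ.toAddMonoidHom m n h

/-- The action of `ℤ² ⋊ SL(2, ℤ)` on `Λ(H)` by group automorphisms. -/
def lamActEquiv (g : AffineSL) : Lam H ≃+ Lam H :=
  { lamAct H g with map_add' := lamAct_add g }

theorem lamActEquiv_apply (g : AffineSL) (a : Lam H) : lamActEquiv g a = lamAct H g a := rfl

instance [Countable H] : Countable (Lam H) := Subtype.countable

instance [Nontrivial H] : Infinite (Lam H) := by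
  obtain ⟨h, hh⟩ := exists_ne (0 : H)
  refine Infinite.of_injective (fun n : ℕ => dif ![(n : ℤ) + 1, 0] 0 h) fun n n' heq => ?_
  classical
  have h1 := congrArg (fun a : Lam H => a.1 ![(n : ℤ) + 1, 0]) heq
  have h0 : (0 : Fin 2 → ℤ) ≠ ![(n : ℤ) + 1, 0] := by
    intro h
    have := congrFun h 0
    simp at this
    omega
  simp only [dif_apply, if_true, if_neg h0, sub_zero] at h1
  by_contra hne
  rw [if_neg] at h1
  · exact hh h1
  · intro h2
    have := congrFun h2 0
    simp at this
    exact hne this.symm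

/-- A nontrivial affine map moves infinitely many points. -/
theorem infinite_moved {g : AffineSL} (hg : g ≠ 1) : {m : Fin 2 → ℤ | g • m ≠ m}.Infinite := by
  have h1 : ∃ m : Fin 2 → ℤ, g • m ≠ m := by
    by_contra! hall
    apply hg
    have hl : g.left.toAdd = 0 := by
      have := hall 0
      rwa [affine_smul_def, Matrix.mulVec_zero, add_zero] at this
    have hr : ∀ m, g.right.1.mulVec m = m := fun m => by
      have := hall m
      rwa [affine_smul_def, hl, zero_add] at this
    apply SemidirectProduct.ext
    · exact hl
    · apply Subtype.ext
      exact Matrix.ext_of_mulVec_single fun i => by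
        rw [hr]
        funext j
        fin_cases i <;> fin_cases j <;> simp
  obtain ⟨p, hp⟩ := h1
  set u : Fin 2 → ℤ := g • p - p with hu
  set w : Fin 2 → ℤ := g.right.1.mulVec ![1, 0] - ![1, 0] with hw
  -- On the horizontal line through the moved point p the displacement is u + t w with u ≠ 0, so it
  -- vanishes for at most one t.
  have key : ∀ t : ℤ, g • (p + t • ![1, 0]) - (p + t • ![1, 0]) = u + t • w := by
    intro t
    rw [hu, hw, affine_smul_def, affine_smul_def, Matrix.mulVec_add, Matrix.mulVec_smul, smul_sub]
    abel
  have hinj : Function.Injective fun t : ℤ => p + t • (![1, 0] : Fin 2 → ℤ) := by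
    intro t t' h
    have := congrFun h 0
    simpa using this
  have hT : {t : ℤ | u + t • w ≠ 0}.Infinite := by
    have hsub : {t : ℤ | u + t • w = 0}.Subsingleton := by
      intro t ht t' ht'
      rw [Set.mem_ofPred_eq] at ht ht'
      by_contra hne
      have h2 : (t - t') • w = 0 := by
        rw [sub_smul, ← add_sub_add_left_eq_sub _ _ u, ht, ht', sub_zero]
      rw [smul_eq_zero, or_iff_right (sub_ne_zero.2 hne)] at h2
      rw [h2, smul_zero, add_zero, hu, sub_eq_zero] at ht
      exact hp ht
    exact hsub.finite.infinite_compl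
  refine (hT.image hinj.injOn).mono ?_
  rintro _ ⟨t, ht, rfl⟩ heq
  apply ht
  rw [← key, sub_eq_zero]
  exact heq

/-- A finite range would confine all supports to a finite set. But every point m moved by g lies in
one of them: take a with value h at m and -h at a point n away from m and g⁻¹ • m. -/
theorem infinite_range_lamAct_sub [Nontrivial H] {g : AffineSL} (hg : g ≠ 1) :
    (Set.range fun a : Lam H => lamAct H g a - a).Infinite := by
  obtain ⟨h, hh⟩ := exists_ne (0 : H)
  intro hfin
  have hfin2 : (⋃ b ∈ (Set.range fun a : Lam H => lamAct H g a - a),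
      (b.1.support : Set (Fin 2 → ℤ))).Finite :=
    hfin.biUnion fun b _ => b.1.support.finite_toSet
  refine infinite_moved hg (hfin2.subset fun m hm => ?_)
  have hm' : g⁻¹ • m ≠ m := by
    intro h
    apply hm
    conv_lhs => rw [← h]
    rw [smul_inv_smul]
  obtain ⟨n, hn⟩ := ((Set.finite_singleton m).insert (g⁻¹ • m)).infinite_compl.nonempty
  simp only [Set.mem_compl_iff, Set.mem_insert_iff, Set.mem_singleton_iff, not_or] at hn
  refine Set.mem_biUnion ⟨dif m n h, rfl⟩ ?_
  classical
  simp only [Finset.mem_coe, Finsupp.mem_support_iff]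
  rw [lam_sub_apply, lamAct_apply, dif_apply, dif_apply, if_neg hm'.symm, if_neg hn.1, if_pos rfl,
    if_neg hn.2]
  simpa using hh

end LamGenerators

/-! ### Fourier coefficients and convolution. -/

section Coefficients

variable {X : Type*} [MeasurableSpace X] {μ : Measure X} [IsProbabilityMeasure μ]
  {L : Type*}

/-- The Fourier coefficient of `f` at `a`. -/
def coeff (e : L → LInfty μ) (f : LInfty μ) (a : L) : ℂ := inner ℂ (toL2 (e a)) (toL2 f)

theorem coeff_apply {e : L → LInfty μ} {β : LInfty μ ≃⋆ₐ[ℂ] LInfty μ}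
    (hβ : ∀ f, ∫ x, (β f : LInfty μ) x ∂μ = ∫ x, f x ∂μ) {a b : L} (h : β (e a) = e b)
    (f : LInfty μ) : coeff e (β f) b = coeff e f a := by
  rw [coeff, coeff, ← h, inner_toL2, inner_toL2, ← map_star, ← map_mul, hβ]

namespace IsFourierSystem

variable [AddCommGroup L] {e : L → LInfty μ} (he : IsFourierSystem e)
include he

theorem coeff_char_self (a : L) : coeff e (e a) a = 1 := by
  have := he.orthonormal.1 a
  rw [coeff, inner_self_eq_norm_sq_to_K, this]
  norm_num

theorem coeff_char_of_ne {a b : L} (h : b ≠ a) : coeff e (e a) b = 0 := he.orthonormal.2 h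

theorem ext_coeff {f g : LInfty μ} (h : ∀ a, coeff e f a = coeff e g a) : f = g := by
  apply toL2_injective
  apply he.basis.repr.injective
  apply lp.ext
  funext a
  rw [HilbertBasis.repr_apply_apply, HilbertBasis.repr_apply_apply, he.basis_apply]
  exact h a

theorem eq_smul_of_coeff {f : LInfty μ} {a : L} (h : ∀ b, b ≠ a → coeff e f b = 0) :
    f = coeff e f a • e a := by
  apply he.ext_coeff
  intro b
  have h1 : coeff e (coeff e f a • e a) b = coeff e f a * coeff e (e a) b := by
    rw [coeff, ← toL2Linear_apply (coeff e f a • e a), map_smul, inner_smul_right]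
    rfl
  rw [h1]
  by_cases hb : b = a
  · rw [hb, he.coeff_char_self, mul_one]
  · rw [h b hb, he.coeff_char_of_ne hb, mul_zero]

/-- The Fourier coefficients of a product, when only one term of the convolution survives. -/
theorem coeff_mul_of_unique (f g : LInfty μ) (a b : L)
    (h : ∀ c, c ≠ b → coeff e f (a + b - c) * coeff e g c = 0) :
    coeff e (f * g) (a + b) = coeff e f a * coeff e g b := by
  -- Parseval for the pairing of f* e_{a+b} with g is the convolution formula for the coefficient of
  -- f g at a + b.
  have h1 := he.basis.hasSum_inner_mul_inner (toL2 (star f * e (a + b))) (toL2 g)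
  have h2 : inner ℂ (toL2 (star f * e (a + b))) (toL2 g) = coeff e (f * g) (a + b) := by
    rw [coeff, inner_toL2, inner_toL2]
    apply integral_congr_ae
    filter_upwards [coeFn_mul (star (star f * e (a + b))) g, coeFn_star' (star f * e (a + b)),
      coeFn_mul (star f) (e (a + b)), coeFn_star' f, coeFn_mul (star (e (a + b))) (f * g),
      coeFn_star' (e (a + b)), coeFn_mul f g] with x k1 k2 k3 k4 k5 k6 k7
    rw [k1, k2, k3, k4, k5, k6, k7, star_mul, star_star, mul_assoc]
  have h3 : ∀ c, inner ℂ (toL2 (star f * e (a + b))) (he.basis c) * inner ℂ (he.basis c) (toL2 g) =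
      coeff e f (a + b - c) * coeff e g c := by
    intro c
    rw [he.basis_apply, coeff, coeff, inner_toL2 _ (e c), inner_toL2 _ f]
    congr 1
    apply integral_congr_ae
    have hs : e (a + b - c) = e (a + b) * star (e c) := by
      rw [sub_eq_add_neg, he.char_add, he.char_neg]
    filter_upwards [coeFn_mul (star (star f * e (a + b))) (e c), coeFn_star' (star f * e (a + b)),
      coeFn_mul (star f) (e (a + b)), coeFn_star' f, coeFn_mul (star (e (a + b - c))) f,
      coeFn_star' (e (a + b - c)), coeFn_mul (e (a + b)) (star (e c)), coeFn_star' (e c)]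
      with x k1 k2 k3 k4 k5 k6 k7 k8
    rw [k1, k2, k3, k4, k5, k6, hs, k7, k8, star_mul, star_star, star_mul, star_star]
    ring
  simp_rw [h3] at h1
  rw [h2] at h1
  rw [h1.unique (hasSum_single b h), add_sub_cancel_right]

end IsFourierSystem

end Coefficients

/-! ### Ergodicity, and rigidity of automorphisms commuting with the action. -/

section Rigidity

variable {X : Type*} [MeasurableSpace X] {μ : Measure X} [IsProbabilityMeasure μ]
  {H : Type*} [AddCommGroup H] {e : Lam H → LInfty μ} (he : IsFourierSystem e)
include he

/-- Coefficients that are constant along an unbounded orbit vanish. -/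
theorem coeff_eq_zero_of_orbit (f : LInfty μ) (a : Lam H) (g : ℕ → AffineSL) {m : Fin 2 → ℤ}
    (hm : a.1 m ≠ 0) (hinj : Function.Injective fun n => g n • m)
    (h : ∀ n, coeff e f (lamAct H (g n) a) = coeff e f a) : coeff e f a = 0 := by
  by_contra hne
  have hfin := he.finite_le_norm_coeff (toL2 f) (norm_pos_iff.2 hne)
  -- Only finitely many indices carry a coefficient this large, so their supports cover a finite
  -- set; yet it would contain all the points g n • m.
  have hfin2 := hfin.biUnion fun (b : Lam H) _ => b.1.support.finite_toSet
  refine (Set.infinite_range_of_injective hinj) (hfin2.subset ?_)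
  rintro _ ⟨n, rfl⟩
  refine Set.mem_biUnion (x := lamAct H (g n) a) ?_ ?_
  · rw [Set.mem_ofPred_eq]
    exact (congrArg norm (h n)).ge
  · simp only [Finset.mem_coe, Finsupp.mem_support_iff]
    rwa [lamAct_smul_apply]

variable {β : AffineSL →* (LInfty μ ≃⋆ₐ[ℂ] LInfty μ)} (hβ : TracePreserving β)
  (hβe : ∀ g a, β g (e a) = e (lamAct H g a))
include hβ hβe

/-- The shift action is ergodic. -/
theorem isErgodic_of_char : IsErgodic β := by
  intro f hf
  have h1 : ∀ a : Lam H, a ≠ 0 → coeff e f a = 0 := by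
    intro a ha
    obtain ⟨m, hm⟩ : ∃ m, a.1 m ≠ 0 := by
      by_contra! hall
      exact ha (lam_ext hall)
    refine coeff_eq_zero_of_orbit he f a (fun n => translation ![(n : ℤ), 0]) hm ?_ fun n => ?_
    · intro n n' hn
      have := congrFun hn 0
      simp only [translation_smul] at this
      simpa using this
    · conv_lhs => rw [← hf (translation ![(n : ℤ), 0])]
      exact coeff_apply (hβ _) (hβe _ _) f
  have h2 := he.eq_smul_of_coeff h1
  refine ⟨coeff e f 0, ?_⟩
  rw [he.char_zero] at h2
  have h3 := Lp.coeFn_smul (coeff e f 0) (linftyOne μ)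
  rw [← h2] at h3
  filter_upwards [h3, coeFn_linftyOne (μ := μ)] with x k1 k2
  rw [k1, Pi.smul_apply, k2, smul_eq_mul, mul_one]

variable {α : LInfty μ ≃⋆ₐ[ℂ] LInfty μ} (hα : ∀ g f, α (β g f) = β g (α f))
include hα

omit he in
theorem coeff_equivariant (g : AffineSL) (a b : Lam H) :
    coeff e (α (e (lamAct H g a))) (lamAct H g b) = coeff e (α (e a)) b := by
  rw [← hβe, hα]
  exact coeff_apply (hβ g) (hβe g b) _

/-- The shears (x, y) ↦ (x + n y, y) fix 0 and (1,0), hence the character, and send every point off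
the first axis to infinity. -/
theorem coeff_support_line (h : H) {a : Lam H} (ha : coeff e (α (e (dif 0 ![1, 0] h))) a ≠ 0)
    {m : Fin 2 → ℤ} (hm : m 1 ≠ 0) : a.1 m = 0 := by
  by_contra hne
  apply ha
  refine coeff_eq_zero_of_orbit he _ a (fun n => affine 0 1 n 0 1 (by norm_num)) hne ?_ fun n => ?_
  · intro n n' hn
    have := congrFun hn 0
    simp only [affine_smul] at this
    simpa [hm] using this
  · have := coeff_equivariant hβ hβe hα (affine 0 1 n 0 1 (by norm_num)) (dif 0 ![1, 0] h) a
    rw [lamAct_dif] at this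
    have h0 : affine 0 1 (n : ℤ) 0 1 (by norm_num) • (0 : Fin 2 → ℤ) = 0 := by
      rw [affine_smul]
      funext i
      fin_cases i <;> simp
    have h1 : affine 0 1 (n : ℤ) 0 1 (by norm_num) • (![1, 0] : Fin 2 → ℤ) = ![1, 0] := by
      rw [affine_smul]
      funext i
      fin_cases i <;> simp
    rw [h0, h1] at this
    exact this

omit hβ hβe hα in
theorem apply_char_ne_zero (a : Lam H) : ∃ b, coeff e (α (e a)) b ≠ 0 := by
  by_contra! hall
  have h0 : α (e a) = 0 := he.ext_coeff fun b => by
    rw [hall b, coeff, ← toL2Linear_apply 0, map_zero, inner_zero_right]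
  have h1 : e a = 0 := EquivLike.injective α (by rw [h0, map_zero])
  have h2 := he.coeff_char_self a
  conv_lhs at h2 => rw [coeff]; arg 3; rw [h1, ← toL2Linear_apply, map_zero]
  rw [inner_zero_right] at h2
  exact zero_ne_one h2

/-- An automorphism that commutes with the action maps the characters of the functions supported
at `0` and `(1, 0)` to characters of the same kind. -/
theorem exists_apply_char_dif (h : H) :
    ∃ h' : H, α (e (dif 0 ![1, 0] h)) = e (dif 0 ![1, 0] h') := by
  classical
  set d : Lam H := dif 0 ![1, 0] h with hd
  -- R sends the segment from 0 to (1,0) to the segment from (1,0) to (1,1), and D sends it to the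
  -- one from 0 to (1,1): the three sides of a triangle.
  let R : AffineSL := affine ![1, 0] 0 (-1) 1 0 (by norm_num)
  let D : AffineSL := affine 0 1 0 1 1 (by norm_num)
  have hRs : ∀ m : Fin 2 → ℤ, R • m = ![1 - m 1, m 0] := fun m => by
    simp only [R, affine_smul]
    funext i
    fin_cases i <;> simp [sub_eq_add_neg]
  have hDs : ∀ m : Fin 2 → ℤ, D • m = ![m 0, m 0 + m 1] := fun m => by
    simp only [D, affine_smul]
    funext i
    fin_cases i <;> simp
  have hR0 : R • (0 : Fin 2 → ℤ) = ![1, 0] := by rw [hRs]; simp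
  have hR1 : R • (![1, 0] : Fin 2 → ℤ) = ![1, 1] := by rw [hRs]; simp
  have hD0 : D • (0 : Fin 2 → ℤ) = 0 := by
    rw [hDs]
    funext i
    fin_cases i <;> simp
  have hD1 : D • (![1, 0] : Fin 2 → ℤ) = ![1, 1] := by rw [hDs]; simp
  have htri : ∀ k : H, dif 0 ![1, 0] k + lamAct H R (dif 0 ![1, 0] k) =
      lamAct H D (dif 0 ![1, 0] k) := fun k => by
    rw [lamAct_dif, lamAct_dif, hR0, hR1, hD0, hD1, dif_add_dif]
  set F : Lam H → ℂ := coeff e (α (e d)) with hF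
  have hFR : ∀ c, coeff e (α (e (lamAct H R d))) c = F (lamAct H R⁻¹ c) := fun c => by
    conv_lhs => rw [← lamAct_apply_inv_self R c]
    exact coeff_equivariant hβ hβe hα R d _
  have hFD : ∀ c, coeff e (α (e (lamAct H D d))) c = F (lamAct H D⁻¹ c) := fun c => by
    conv_lhs => rw [← lamAct_apply_inv_self D c]
    exact coeff_equivariant hβ hβe hα D d _
  have hmul : α (e d) * α (e (lamAct H R d)) = α (e (lamAct H D d)) := by
    rw [← map_mul, ← he.char_add, htri]
  have hline : ∀ c, F c ≠ 0 → ∀ m : Fin 2 → ℤ, m 1 ≠ 0 → c.1 m = 0 := fun c hc m hm =>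
    coeff_support_line he hβ hβe hα h hc hm
  have hlineR : ∀ c, F (lamAct H R⁻¹ c) ≠ 0 → ∀ m : Fin 2 → ℤ, m 0 ≠ 1 → c.1 m = 0 := by
    intro c hc m hm
    have hq : m = R • ![m 1, 1 - m 0] := by
      rw [hRs]
      funext i
      fin_cases i <;> simp
    have := hline _ hc ![m 1, 1 - m 0] (by simpa [sub_eq_zero] using hm.symm)
    rw [lamAct_apply, inv_inv, ← hq] at this
    exact this
  have hlineD : ∀ c, F (lamAct H D⁻¹ c) ≠ 0 → ∀ m : Fin 2 → ℤ, m 0 ≠ m 1 → c.1 m = 0 := by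
    intro c hc m hm
    have hq : m = D • ![m 0, m 1 - m 0] := by
      rw [hDs]
      funext i
      fin_cases i <;> simp
    have := hline _ hc ![m 0, m 1 - m 0] (by simpa [sub_eq_zero] using hm.symm)
    rw [lamAct_apply, inv_inv, ← hq] at this
    exact this
  -- Two splittings of one element into a piece on the axis and a piece on the line x = 1 differ by
  -- an element supported at the single common point (1,0). Its value there is 0 because values sum
  -- to zero, so one term of the convolution remains.
  have hprod : ∀ c₁ c₂, F c₁ ≠ 0 → F c₂ ≠ 0 →
      F (lamAct H D⁻¹ (c₁ + lamAct H R c₂)) = F c₁ * F c₂ := by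
    intro c₁ c₂ h1 h2
    have h2' : F (lamAct H R⁻¹ (lamAct H R c₂)) ≠ 0 := by rwa [lamAct_inv_apply_self]
    rw [← hFD, ← hmul, he.coeff_mul_of_unique, hFR, lamAct_inv_apply_self]
    intro c hc
    by_contra hne
    obtain ⟨h3, h4⟩ := mul_ne_zero_iff.1 hne
    rw [hFR] at h4
    apply hc
    rw [← sub_eq_zero]
    apply lam_eq_zero_of_support (m := ![1, 0])
    intro p hp
    by_cases hp1 : p 1 = 0
    · have hp0 : p 0 ≠ 1 := by
        intro h0
        apply hp
        funext i
        fin_cases i <;> simp [h0, hp1]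
      rw [lam_sub_apply, hlineR c h4 p hp0, hlineR _ h2' p hp0, sub_zero]
    · have e1 := hline _ h3 p hp1
      have e2 := hline _ h1 p hp1
      rw [lam_sub_apply, lam_add_apply, e2, zero_add] at e1
      rw [lam_sub_apply, ← neg_sub, e1, neg_zero]
  -- The sum of c₁ and R·c₂ lives on the diagonal. Points of the axis other than 0 and (1,0) see
  -- only c₁, which therefore vanishes there; at (1,0) the values c₁(1,0) and c₂(0) cancel.
  have huniq : ∀ c₁ c₂, F c₁ ≠ 0 → F c₂ ≠ 0 → c₁ = dif 0 ![1, 0] (c₂.1 0) := by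
    intro c₁ c₂ h1 h2
    have h2' : F (lamAct H R⁻¹ (lamAct H R c₂)) ≠ 0 := by rwa [lamAct_inv_apply_self]
    have h3 := hlineD (c₁ + lamAct H R c₂) (by rw [hprod c₁ c₂ h1 h2]; exact mul_ne_zero h1 h2)
    have h4 : -c₁.1 ![1, 0] = c₂.1 0 := by
      have := h3 ![1, 0] (by simp)
      rw [lam_add_apply, ← hR0, lamAct_smul_apply, hR0] at this
      exact neg_eq_of_add_eq_zero_right this
    rw [← h4]
    apply lam_eq_dif_of_support
    intro p hp0 hp1
    by_cases hp : p 1 = 0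
    · have h5 : p 0 ≠ 0 := fun h0 => hp0 (by
        funext i
        fin_cases i <;> simp [h0, hp])
      have h6 : p 0 ≠ 1 := fun h0 => hp1 (by
        funext i
        fin_cases i <;> simp [h0, hp])
      have := h3 p (by rw [hp]; exact h5)
      rwa [lam_add_apply, hlineR _ h2' p h6, add_zero] at this
    · exact hline c₁ h1 p hp
  obtain ⟨c, hc⟩ := apply_char_ne_zero he d
  have hcd := huniq c c hc hc
  -- Since c has the shape of d, the triangle relation holds for c too, and `hprod` reads F(c) =
  -- F(c)².
  have hF1 : F c = 1 := by
    have := hprod c c hc hc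
    conv_lhs at this => rw [hcd, htri, lamAct_inv_apply_self, ← hcd]
    exact (mul_eq_left₀ hc).1 this.symm
  refine ⟨c.1 0, ?_⟩
  rw [← hcd, he.eq_smul_of_coeff (f := α (e d)) (a := c) fun b hb => by
    by_contra hne
    exact hb ((huniq b c hne hc).trans hcd.symm)]
  change F c • e c = e c
  rw [hF1, one_smul]

/-- An automorphism that commutes with the action permutes the characters by an endomorphism of
`H`. -/
theorem exists_apply_char :
    ∃ φ : H →+ H, ∀ a, α (e a) = e (mapLam φ a) := by
  choose φ hφ using exists_apply_char_dif he hβ hβe hα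
  have hne : (0 : Fin 2 → ℤ) ≠ ![1, 0] := fun h => by simpa using congrFun h 0
  let Φ : H →+ H := AddMonoidHom.mk' φ fun h h' => by
    apply dif_injective hne
    apply he.injective
    rw [← hφ, dif_add, dif_add, he.char_add, map_mul, hφ, hφ, he.char_add]
  refine ⟨Φ, ?_⟩
  -- The elements on which α is given by Φ form an invariant subgroup, so the generators of
  -- `lam_induction` decide.
  let S : AddSubgroup (Lam H) :=
    { carrier := {a | α (e a) = e (mapLam Φ a)}
      zero_mem' := by
        change α (e 0) = e (mapLam Φ 0)
        rw [map_zero, he.char_zero, starAlgEquiv_linftyOne]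
      add_mem' := fun {a b} ha hb => by
        change α (e (a + b)) = e (mapLam Φ (a + b))
        rw [Set.mem_ofPred_eq] at ha hb
        rw [map_add, he.char_add, he.char_add, map_mul, ha, hb]
      neg_mem' := fun {a} ha => by
        change α (e (-a)) = e (mapLam Φ (-a))
        rw [Set.mem_ofPred_eq] at ha
        rw [map_neg, he.char_neg, he.char_neg, map_star, ha] }
  intro a
  refine lam_induction S (fun h => ?_) (fun g a ha => ?_) a
  · change α (e _) = e (mapLam Φ _)
    rw [hφ, mapLam_dif]
    rfl
  · change α (e _) = e (mapLam Φ _)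
    have ha' : α (e a) = e (mapLam Φ a) := ha
    rw [← hβe, hα, ha', hβe, mapLam_lamAct]

end Rigidity

/-- An action by *-automorphisms transported by a *-isomorphism. -/
def conjAction {G A B : Type*} [Group G] [Add A] [Mul A] [SMul ℂ A] [Star A] [Add B] [Mul B]
    [SMul ℂ B] [Star B] (θ : A ≃⋆ₐ[ℂ] B) (ρ : G →* (B ≃⋆ₐ[ℂ] B)) : G →* (A ≃⋆ₐ[ℂ] A) where
  toFun g := (θ.trans (ρ g)).trans θ.symm
  map_one' := by
    apply DFunLike.ext
    intro f
    change θ.symm (ρ 1 (θ f)) = f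
    rw [map_one]
    exact θ.symm_apply_apply f
  map_mul' g h := by
    apply DFunLike.ext
    intro f
    change θ.symm (ρ (g * h) (θ f)) = θ.symm (ρ g (θ (θ.symm (ρ h (θ f)))))
    rw [map_mul, StarAlgEquiv.apply_symm_apply]
    rfl

theorem apply_conjAction {G A B : Type*} [Group G] [Add A] [Mul A] [SMul ℂ A] [Star A] [Add B]
    [Mul B] [SMul ℂ B] [Star B] (θ : A ≃⋆ₐ[ℂ] B) (ρ : G →* (B ≃⋆ₐ[ℂ] B)) (g : G) (x : A) :
    θ (conjAction θ ρ g x) = ρ g (θ x) := θ.apply_symm_apply _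

theorem conjAction_symm_apply {G A B : Type*} [Group G] [Add A] [Mul A] [SMul ℂ A] [Star A]
    [Add B] [Mul B] [SMul ℂ B] [Star B] (θ : A ≃⋆ₐ[ℂ] B) (ρ : G →* (B ≃⋆ₐ[ℂ] B)) (g : G) (x : B) :
    θ.symm (ρ g x) = conjAction θ ρ g (θ.symm x) := by
  conv_lhs => rw [← θ.apply_symm_apply x]
  rfl

/-! ### The shift action on L^∞(X, μ) and its freeness. -/

section Realization

variable {X : Type*} [MeasurableSpace X] {μ : Measure X} [IsProbabilityMeasure μ]

/-- A *-automorphism as a linear map. -/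
def starAlgEquivLinear (α : LInfty μ ≃⋆ₐ[ℂ] LInfty μ) : LInfty μ →ₗ[ℂ] LInfty μ where
  toFun := α
  map_add' := map_add α
  map_smul' := map_smul α

theorem norm_toL2_apply {α : LInfty μ ≃⋆ₐ[ℂ] LInfty μ}
    (hα : ∀ f, ∫ x, (α f : LInfty μ) x ∂μ = ∫ x, f x ∂μ) (f : LInfty μ) :
    ‖toL2 (α f)‖ = ‖toL2 f‖ :=
  norm_toL2_of_integral (T := α) (map_mul α) (map_star α) hα f

theorem IsFourierSystem.starAlgEquiv_ext {L : Type*} [AddCommGroup L] {e : L → LInfty μ}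
    (he : IsFourierSystem e) {α β : LInfty μ ≃⋆ₐ[ℂ] LInfty μ}
    (hα : ∀ f, ∫ x, (α f : LInfty μ) x ∂μ = ∫ x, f x ∂μ)
    (hβ : ∀ f, ∫ x, (β f : LInfty μ) x ∂μ = ∫ x, f x ∂μ) (h : ∀ a, α (e a) = β (e a)) :
    α = β := by
  have := he.eq_of_isometric (starAlgEquivLinear α) (starAlgEquivLinear β) (norm_toL2_apply hα)
    (norm_toL2_apply hβ) h
  exact DFunLike.ext _ _ fun f => DFunLike.congr_fun this f

/-- Composition with T is linear and isometric for the 2-norm, as α is, so agreement on characters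
suffices. -/
theorem IsFourierSystem.apply_ae_eq_comp {L : Type*} [AddCommGroup L] {e : L → LInfty μ}
    (he : IsFourierSystem e) {α : LInfty μ ≃⋆ₐ[ℂ] LInfty μ}
    (hα : ∀ f, ∫ x, (α f : LInfty μ) x ∂μ = ∫ x, f x ∂μ) {T : X → X}
    (hT : MeasurePreserving T μ μ) (h : ∀ a, ⇑(α (e a) : LInfty μ) =ᵐ[μ] ⇑(e a) ∘ T)
    (f : LInfty μ) : ⇑(α f : LInfty μ) =ᵐ[μ] ⇑f ∘ T := by
  let C : LInfty μ →ₗ[ℂ] LInfty μ := Lp.compMeasurePreservingₗ ℂ T hT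
  have hC : ∀ f, ⇑(C f) =ᵐ[μ] ⇑f ∘ T := fun f => Lp.coeFn_compMeasurePreserving f hT
  have hiso : ∀ f, ‖toL2 (C f)‖ = ‖toL2 f‖ := by
    intro f
    have : toL2 (C f) = Lp.compMeasurePreserving T hT (toL2 f) := by
      apply Lp.ext
      filter_upwards [coeFn_toL2 (C f), hC f, Lp.coeFn_compMeasurePreserving (toL2 f) hT,
        hT.quasiMeasurePreserving.ae (coeFn_toL2 f)] with x h1 h2 h3 h4
      rw [h1, h2, h3, Function.comp, Function.comp, h4]
    rw [this]
    exact Lp.norm_compMeasurePreserving _ hT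
  have := he.eq_of_isometric (starAlgEquivLinear α) C (norm_toL2_apply hα) hiso
    fun a => Lp.ext ((h a).trans (hC (e a)).symm)
  have h2 : α f = C f := DFunLike.congr_fun this f
  rw [h2]
  exact hC f

variable {H : Type*} [AddCommGroup H] {e : Lam H → LInfty μ} (he : IsFourierSystem e)
include he

/-- The action on `L^∞(X, μ)` that corresponds to the shift action. -/
def transportedAction : AffineSL →* (LInfty μ ≃⋆ₐ[ℂ] LInfty μ) :=
  conjAction he.equivVN (shiftAction H)

theorem equivVN_transportedAction (g : AffineSL) (f : LInfty μ) :
    he.equivVN (transportedAction he g f) = shiftAction H g (he.equivVN f) :=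
  apply_conjAction he.equivVN (shiftAction H) g f

theorem transportedAction_char (g : AffineSL) (a : Lam H) :
    transportedAction he g (e a) = e (lamAct H g a) := by
  apply EquivLike.injective he.equivVN
  refine (equivVN_transportedAction he g (e a)).trans ?_
  refine (congrArg (shiftAction H g) (he.equivVN_char a)).trans ?_
  refine Eq.trans ?_ (he.equivVN_char (lamAct H g a)).symm
  exact Subtype.ext (shiftAction_leftReg H g a)

omit he in
theorem canonicalTrace_shiftAction (g : AffineSL) (x : shiftVN H) :
    canonicalTrace (shiftAction H g x) = canonicalTrace x :=
  inner_conj_delta0 (lamAct H g) (map_zero (lamActEquiv g)) x.1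

theorem tracePreserving_transportedAction : TracePreserving (transportedAction he) := by
  intro g f
  refine (he.canonicalTrace_equivVN _).symm.trans ?_
  refine (congrArg canonicalTrace (equivVN_transportedAction he g f)).trans ?_
  exact (canonicalTrace_shiftAction g _).trans (he.canonicalTrace_equivVN f)

/-- The isomorphism of the group von Neumann algebra with `L^∞(X, μ)`. -/
def shiftEquiv : shiftVN H ≃⋆ₐ[ℂ] LInfty μ := he.equivVN.symm

theorem integral_shiftEquiv (x : shiftVN H) :
    ∫ t, (shiftEquiv he x : LInfty μ) t ∂μ = canonicalTrace x :=
  (he.canonicalTrace_equivVN _).symm.trans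
    (congrArg canonicalTrace (he.equivVN.apply_symm_apply x))

theorem shiftEquiv_shiftAction (g : AffineSL) (x : shiftVN H) :
    shiftEquiv he (shiftAction H g x) = transportedAction he g (shiftEquiv he x) :=
  conjAction_symm_apply he.equivVN (shiftAction H) g x

theorem isEssentiallyFree_transportedAction [Countable H] [Nontrivial H]
    (hsp : ∀ σ : Lam H ≃+ Lam H, ∃ T : X → X, MeasurePreserving T μ μ ∧
      ∀ a, ⇑(e (σ a)) =ᵐ[μ] ⇑(e a) ∘ T) : IsEssentiallyFree (transportedAction he) := by
  intro g hg
  obtain ⟨T, hT, hTe⟩ := hsp (lamActEquiv g)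
  refine ⟨T, hT, he.apply_ae_eq_comp (tracePreserving_transportedAction he g) hT fun a => ?_, ?_⟩
  · rw [transportedAction_char]
    exact hTe a
  · let A : Set X := ⋂ a : Lam H, {x | e (lamAct H g a - a) x = 1}
    have hA : MeasurableSet A := MeasurableSet.iInter fun a =>
      (Lp.stronglyMeasurable (e (lamAct H g a - a))).measurable (measurableSet_singleton 1)
    have h0 : μ A = 0 := by
      refine he.measure_eq_zero_of_infinite hA (infinite_range_lamAct_sub hg) ?_
      rintro _ ⟨a, rfl⟩
      exact ⟨1, norm_one, .of_forall fun x hx => Set.mem_iInter.1 hx a⟩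
    have h1 : ∀ᵐ x ∂μ, ∀ a, T x = x → e (lamAct H g a - a) x = 1 := by
      rw [ae_all_iff]
      intro a
      have e0 : e (lamAct H g a - a) = e (lamAct H g a) * e (-a) := by
        rw [sub_eq_add_neg, he.char_add]
      have e1 : e a * e (-a) = linftyOne μ := by
        rw [← he.char_add, add_neg_cancel, he.char_zero]
      have k1 := coeFn_mul (e (lamAct H g a)) (e (-a))
      have k2 := coeFn_mul (e a) (e (-a))
      rw [← e0] at k1
      rw [e1] at k2
      filter_upwards [k1, k2, hTe a, coeFn_linftyOne (μ := μ)] with x h1 h2 h3 h4 hx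
      rw [lamActEquiv_apply, Function.comp, hx] at h3
      rw [h1, h3, ← h2, h4]
    have h2 : ∀ᵐ x ∂μ, x ∉ A := measure_eq_zero_iff_ae_notMem.1 h0
    filter_upwards [h1, h2] with x k1 k2 hx
    exact k2 (Set.mem_iInter.2 fun a => k1 a hx)

end Realization

/-! ### Pointwise convergence in Aut(H). -/

section Topology

open Filter Topology

variable {H : Type*} [AddCommGroup H]

theorem eventually_addAut_apply_eq (φ₀ : Multiplicative (AddAut H)) (h : H) :
    ∀ᶠ φ in 𝓝 φ₀, φ.toAdd h = φ₀.toAdd h := by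
  let : TopologicalSpace H := ⊥
  have : DiscreteTopology H := ⟨rfl⟩
  have h1 : Continuous fun φ : AddAut H => fun h : H => φ h := continuous_induced_dom
  have h2 : Continuous fun φ : Multiplicative (AddAut H) => φ.toAdd h :=
    (continuous_apply h).comp (h1.comp continuous_toAdd)
  exact (h2.tendsto φ₀).eventually (IsOpen.mem_nhds (isOpen_discrete {φ₀.toAdd h}) rfl)

/-- The support of a is finite, so only finitely many values of φ matter. -/
theorem eventually_mapLamEquiv_eq (φ₀ : Multiplicative (AddAut H)) (a : Lam H) :
    ∀ᶠ φ in 𝓝 φ₀, mapLamEquiv φ.toAdd a = mapLamEquiv φ₀.toAdd a := by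
  have : ∀ᶠ φ in 𝓝 φ₀, ∀ m ∈ a.1.support, φ.toAdd (a.1 m) = φ₀.toAdd (a.1 m) :=
    (Filter.eventually_all_finset _).2 fun m _ => eventually_addAut_apply_eq φ₀ (a.1 m)
  filter_upwards [this] with φ hφ
  apply lam_ext
  intro m
  rw [mapLamEquiv_apply, mapLamEquiv_apply]
  by_cases hm : m ∈ a.1.support
  · exact hφ m hm
  · rw [Finsupp.notMem_support_iff.1 hm, map_zero, map_zero]

theorem continuous_to_addAut {Y : Type*} [TopologicalSpace Y] (f : Y → Multiplicative (AddAut H))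
    (hf : ∀ y₀ h, ∀ᶠ y in 𝓝 y₀, (f y).toAdd h = (f y₀).toAdd h) : Continuous f := by
  let : TopologicalSpace H := ⊥
  have h1 : Continuous fun y => (f y).toAdd :=
    continuous_induced_rng.2 (continuous_pi fun h =>
      ((IsLocallyConstant.iff_eventually_eq _).2 fun y₀ => hf y₀ h).continuous)
  exact continuous_ofAdd.comp h1

end Topology

/-! ### The commutant of the action is Aut(H). -/

section Commutant

open Filter Topology

variable {X : Type*} [MeasurableSpace X] {μ : Measure X} [IsProbabilityMeasure μ]
  {H : Type*} [AddCommGroup H] {e : Lam H → LInfty μ} (he : IsFourierSystem e)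
include he

/-- The automorphism of `L^∞(X, μ)` induced by an automorphism of `H`. -/
def inducedAut (φ : AddAut H) : LInfty μ ≃⋆ₐ[ℂ] LInfty μ :=
  (he.exists_starAlgEquiv (mapLamEquiv φ)).choose

theorem inducedAut_char (φ : AddAut H) (a : Lam H) :
    inducedAut he φ (e a) = e (mapLamEquiv φ a) :=
  (he.exists_starAlgEquiv (mapLamEquiv φ)).choose_spec.1 a

theorem integral_inducedAut (φ : AddAut H) (f : LInfty μ) :
    ∫ x, (inducedAut he φ f : LInfty μ) x ∂μ = ∫ x, f x ∂μ :=
  (he.exists_starAlgEquiv (mapLamEquiv φ)).choose_spec.2 f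

theorem inducedAut_mem {β : AffineSL →* (LInfty μ ≃⋆ₐ[ℂ] LInfty μ)} (hβ : TracePreserving β)
    (hβe : ∀ g a, β g (e a) = e (lamAct H g a)) (φ : AddAut H) :
    inducedAut he φ ∈ AutCommuting β := by
  rw [Subgroup.mem_centralizer_iff]
  rintro _ ⟨g, rfl⟩
  refine he.starAlgEquiv_ext (fun f => ?_) (fun f => ?_) fun a => ?_
  · rw [StarAlgEquiv.mul_apply, hβ, integral_inducedAut]
  · rw [StarAlgEquiv.mul_apply, integral_inducedAut, hβ]
  · rw [StarAlgEquiv.mul_apply, StarAlgEquiv.mul_apply, hβe, inducedAut_char, inducedAut_char, hβe]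
    exact congrArg e (mapLam_lamAct φ.toAddMonoidHom g a).symm

/-- The endomorphisms of H obtained from α and from α⁻¹ are mutually inverse. The characters e a
with a ≠ 0 go to characters of integral zero, so `hdet` shows that α preserves the trace, and its
values on characters then determine it. -/
theorem exists_inducedAut_eq (hdet : IsDetermining e)
    {β : AffineSL →* (LInfty μ ≃⋆ₐ[ℂ] LInfty μ)}
    (hβ : TracePreserving β) (hβe : ∀ g a, β g (e a) = e (lamAct H g a))
    {α : LInfty μ ≃⋆ₐ[ℂ] LInfty μ} (hα : α ∈ AutCommuting β) :
    ∃ φ : AddAut H, inducedAut he φ = α := by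
  have hcomm : ∀ γ ∈ AutCommuting β, ∀ g f, γ (β g f) = β g (γ f) := fun γ hγ g f => by
    have := Subgroup.mem_centralizer_iff.1 hγ (β g) ⟨g, rfl⟩
    exact (DFunLike.congr_fun this f).symm
  obtain ⟨φ, hφ⟩ := exists_apply_char he hβ hβe (hcomm α hα)
  obtain ⟨ψ, hψ⟩ := exists_apply_char he hβ hβe (hcomm α⁻¹ (inv_mem hα))
  have hne : (0 : Fin 2 → ℤ) ≠ ![1, 0] := fun h => by simpa using congrFun h 0
  have h1 : ∀ h, φ (ψ h) = h := fun h => by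
    apply dif_injective hne
    apply he.injective
    rw [← mapLam_dif, ← mapLam_dif, ← hφ, ← hψ, ← StarAlgEquiv.mul_apply, mul_inv_cancel,
      StarAlgEquiv.one_apply]
  have h2 : ∀ h, ψ (φ h) = h := fun h => by
    apply dif_injective hne
    apply he.injective
    rw [← mapLam_dif, ← mapLam_dif, ← hψ, ← hφ, ← StarAlgEquiv.mul_apply, inv_mul_cancel,
      StarAlgEquiv.one_apply]
  let Φ : AddAut H := { φ with invFun := ψ, left_inv := h2, right_inv := h1 }
  have hΦ : ∀ a, α (e a) = e (mapLamEquiv Φ a) := hφ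
  refine ⟨Φ, he.starAlgEquiv_ext (integral_inducedAut he Φ)
    (hdet.integral_apply_eq α fun a => ?_) fun a => ?_⟩
  · rw [hΦ]
    by_cases ha : a = 0
    · rw [ha, map_zero]
    · rw [he.integral_eq_zero a ha, he.integral_eq_zero _ (by simpa using ha)]
  · rw [inducedAut_char, hΦ]

variable {β : AffineSL →* (LInfty μ ≃⋆ₐ[ℂ] LInfty μ)} (hβ : TracePreserving β)
  (hβe : ∀ g a, β g (e a) = e (lamAct H g a))

/-- Automorphisms of `H` act on `L^∞(X, μ)` and commute with the shift action. -/
def inducedHom : Multiplicative (AddAut H) →* AutCommuting β :=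
  MonoidHom.mk' (fun φ => ⟨inducedAut he φ.toAdd, inducedAut_mem he hβ hβe φ.toAdd⟩)
    fun φ ψ => Subtype.ext (by
      refine he.starAlgEquiv_ext (integral_inducedAut he _) (fun f => ?_) fun a => ?_
      · rw [Subgroup.coe_mul, StarAlgEquiv.mul_apply, integral_inducedAut, integral_inducedAut]
      · rw [Subgroup.coe_mul, StarAlgEquiv.mul_apply, inducedAut_char, inducedAut_char,
          inducedAut_char]
        exact congrArg e (lam_ext fun m => rfl))

theorem inducedHom_char (φ : Multiplicative (AddAut H)) (a : Lam H) :
    (inducedHom he hβ hβe φ).1 (e a) = e (mapLamEquiv φ.toAdd a) := inducedAut_char he φ.toAdd a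

theorem inducedHom_injective : Function.Injective (inducedHom he hβ hβe) := by
  intro φ ψ h
  have hne : (0 : Fin 2 → ℤ) ≠ ![1, 0] := fun h => by simpa using congrFun h 0
  apply Multiplicative.toAdd.injective
  ext k
  apply dif_injective hne
  apply he.injective
  rw [← mapLamEquiv_dif, ← mapLamEquiv_dif, ← inducedHom_char he hβ hβe,
    ← inducedHom_char he hβ hβe, h]

/-- On finite combinations of characters the orbit maps are locally constant; as all induced
automorphisms are 2-norm isometric, approximation is uniform in φ. -/
theorem continuous_inducedHom : Continuous (inducedHom he hβ hβe) := by
  apply Continuous.subtype_mk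
  refine continuous_induced_rng.2 (continuous_pi fun f => ?_)
  change Continuous fun φ : Multiplicative (AddAut H) => toL2 (inducedAut he φ.toAdd f)
  have hspan : ∀ p ∈ Submodule.span ℂ (Set.range e), ∀ φ₀ : Multiplicative (AddAut H),
      ∀ᶠ φ in 𝓝 φ₀, inducedAut he φ.toAdd p = inducedAut he φ₀.toAdd p := by
    intro p hp φ₀
    induction hp using Submodule.span_induction with
    | mem p hp =>
      obtain ⟨a, rfl⟩ := hp
      filter_upwards [eventually_mapLamEquiv_eq φ₀ a] with φ hφ
      rw [inducedAut_char, inducedAut_char, hφ]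
    | zero => exact .of_forall fun φ => by rw [map_zero, map_zero]
    | add p q _ _ hp hq =>
      filter_upwards [hp, hq] with φ h1 h2
      rw [map_add, map_add, h1, h2]
    | smul c p _ hp =>
      filter_upwards [hp] with φ h1
      rw [map_smul, map_smul, h1]
  rw [Metric.continuous_iff']
  intro φ₀ ε hε
  obtain ⟨_, ⟨p, hp, rfl⟩, hpε⟩ := Metric.mem_closure_iff.1
    (he.dense_toL2_span (toL2 f)) (ε / 2) (by positivity)
  have hdist : ∀ φ : AddAut H, dist (toL2 (inducedAut he φ f)) (toL2 (inducedAut he φ p)) < ε / 2 := by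
    intro φ
    rw [dist_eq_norm, ← toL2Linear_apply, ← toL2Linear_apply, ← map_sub, ← map_sub,
      toL2Linear_apply, norm_toL2_apply (integral_inducedAut he φ), ← toL2Linear_apply, map_sub,
      toL2Linear_apply, toL2Linear_apply, ← dist_eq_norm]
    exact hpε
  filter_upwards [hspan p hp φ₀] with φ hφ
  have h1 := hdist φ.toAdd
  rw [hφ] at h1
  have h2 := hdist φ₀.toAdd
  rw [dist_comm] at h2
  linarith [dist_triangle (toL2 (inducedAut he φ.toAdd f)) (toL2 (inducedAut he φ₀.toAdd p))
    (toL2 (inducedAut he φ₀.toAdd f))]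

include hβ hβe in
/-- The automorphisms that commute with the shift action are the automorphisms of `H`. -/
theorem nonempty_autCommuting_equiv (hdet : IsDetermining e) :
    Nonempty (AutCommuting β ≃ₜ* Multiplicative (AddAut H)) := by
  have hsurj : Function.Surjective (inducedHom he hβ hβe) := fun α => by
    obtain ⟨φ, hφ⟩ := exists_inducedAut_eq he hdet hβ hβe α.2
    exact ⟨Multiplicative.ofAdd φ, Subtype.ext hφ⟩
  let Ψ := MulEquiv.ofBijective (inducedHom he hβ hβe) ⟨inducedHom_injective he hβ hβe, hsurj⟩
  have hΨ : ∀ α a, α.1 (e a) = e (mapLamEquiv (Ψ.symm α).toAdd a) := fun α a => by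
    rw [← inducedHom_char he hβ hβe]
    exact congrArg (fun γ : AutCommuting β => γ.1 (e a)) (Ψ.apply_symm_apply α).symm
  refine ⟨{ Ψ.symm with
    continuous_toFun := ?_
    continuous_invFun := continuous_inducedHom he hβ hβe }⟩
  change Continuous Ψ.symm
  have hne : (0 : Fin 2 → ℤ) ≠ ![1, 0] := fun h => by simpa using congrFun h 0
  refine continuous_to_addAut _ fun α₀ h => ?_
  have hi : Continuous fun (α : LInfty μ ≃⋆ₐ[ℂ] LInfty μ) (f : LInfty μ) => toL2 (α f) :=
    continuous_induced_dom
  have hc : Continuous fun α : AutCommuting β => toL2 (α.1 (e (dif 0 ![1, 0] h))) :=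
    (continuous_apply (e (dif 0 ![1, 0] h))).comp (hi.comp continuous_subtype_val)
  -- Characters closer than 1 coincide by `dist_of_ne`, so 2-norm closeness at this one character
  -- fixes the value of the automorphism at h.
  filter_upwards [Metric.continuous_iff'.1 hc α₀ 1 one_pos] with α hα
  apply dif_injective hne
  rw [hΨ, hΨ, dist_eq_norm, mapLamEquiv_dif, mapLamEquiv_dif] at hα
  by_contra hne'
  exact absurd (he.dist_of_ne hne') (not_lt.2 hα.le)

end Commutant

end BernoulliShift

end

open BernoulliShift in
theorem corollary5p2 (H : Type*) [AddCommGroup H] [Countable H] [Nontrivial H]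
    (X : Type*) [MeasurableSpace X] [StandardBorelSpace X]
    (μ : Measure X) [IsProbabilityMeasure μ] [NullSingletonClass μ] :
    ∃ β : AffineSL →* (LInfty μ ≃⋆ₐ[ℂ] LInfty μ),
      TracePreserving β ∧ IsEssentiallyFree β ∧ IsErgodic β ∧
      (∃ Θ : shiftVN H ≃⋆ₐ[ℂ] LInfty μ,
        (∀ x : shiftVN H, ∫ t, (Θ x : LInfty μ) t ∂μ = canonicalTrace x) ∧
        ∀ (g : AffineSL) (x : shiftVN H), Θ (shiftAction H g x) = β g (Θ x)) ∧
      Nonempty (AutCommuting β ≃ₜ* Multiplicative (AddAut H)) := by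
  have hex := exists_isFourierSystem (Lam H) X μ
  obtain ⟨e, he, hdet, hsp⟩ := hex
  have hβ := tracePreserving_transportedAction he
  have hβe := transportedAction_char he
  refine ⟨transportedAction he, hβ, ?_, ?_, ?_, ?_⟩
  · exact isEssentiallyFree_transportedAction he hsp
  · exact isErgodic_of_char he hβ hβe
  · refine ⟨shiftEquiv he, ?_⟩
    constructor
    · intro x
      exact integral_shiftEquiv he x
    · intro g x
      exact shiftEquiv_shiftAction he g x
  · exact nonempty_autCommuting_equiv he hβ hβe hdet
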